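/- Let $N\ge 2$ be an integer, $\epsilon>0$, $\Lambda>0$, and let $P$ be a Borel probability measure on $[0,1]$ with mean $\int \alpha\,P(d\alpha)=\tfrac12$ and variance $\sigma_P^2<\tfrac14$. Let $$\mathcal S_{\epsilon,N}=\Big\{x\in[0,\infty)^N:\ \tfrac1N\sum_{i=1}^N x_i=\epsilon\Big\},$$ and for $1\le i\le N-1$, $\alpha\in[0,1]$ let $T_{i,\alpha}x=x+[\alpha x_{i+1}-(1-\alpha)x_i]\,(e_i-e_{i+1})$, where $e_i$ is the $i$-th unit vector; thus $T_{i,\alpha}$ replaces $(x_i,x_{i+1})$ by $(\alpha(x_i+x_{i+1}),(1-\alpha)(x_i+x_{i+1}))$ and maps $\mathcal S_{\epsilon,N}$ into itself. Let $X(t)$, $t\ge0$, be the Markov process on $\mathcal S_{\epsilon,N}$ with infinitesimal generator $$\mathcal L A(x)=\Lambda\sum_{i=1}^{N-1}\int P(d\alpha)\,[A(T_{i,\alpha}x)-A(x)]$$ acting on the bounded Borel functions $A:\mathcal S_{\epsilon,N}\to\mathbb R$ (with the supremum norm); there is exactly one Markov transition semigroup with this generator. Equip $\mathcal S_{\epsilon,N}$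 with the metric $$d(x,x')=\Big[\sum_{i=1}^{N-1}\Big(\sum_{k=1}^{i}(x_k-x'_k)\Big)^2\Big]^{1/2},$$ and let $W_2(\mu,\mu')=\inf_\Gamma\big[\int d(x,x')^2\,\Gamma(dx,dx')\big]^{1/2}$, the infimum being over all couplings $\Gamma$ of $\mu$ and $\mu'$, be the Vaserstein-2 distance of two probability measures on $\mathcal S_{\epsilon,N}$. Then the process has a unique stationary distribution $\pi_{\epsilon,N}$ on $\mathcal S_{\epsilon,N}$. Furthermore, for every initial distribution $\mu_0$ on $\mathcal S_{\epsilon,N}$ and every $t\ge0$, the distribution $\mu_t$ of $X(t)$ satisfies $$W_2(\mu_t,\pi_{\epsilon,N})\ \le\ W_2(\mu_0,\pi_{\epsilon,N})\,\exp\Big(-\tfrac12\Lambda\,[1-4\sigma_P^2]\,\sin^2\Big[\frac{\pi}{N+2}\Big]\,t\Big)\ \le\ \epsilon N\sqrt{N-1}\,\exp\Big(-\tfrac12\Lambda\,[1-4\sigma_P^2]\,\sin^2\Big[\frac{\pi}{N+2}\Big]\,t\Big).$$ -/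

import Mathlib

open MeasureTheory ProbabilityTheory Filter Topology
open scoped NNReal

noncomputable section

namespace EnergyExchange

/-- The simplex of energy configurations `x ∈ [0,∞)^N` with mean energy `ε` per site. -/
def simplex (ε : ℝ) (N : ℕ) : Set (Fin N → ℝ) :=
  {x | (∀ k, 0 ≤ x k) ∧ ∑ k, (1 / (N : ℝ)) * x k = ε}

/-- The left site of the `i`-th nearest neighbour pair. Sites and pairs are numbered from `0`. -/
def left {N : ℕ} (i : Fin (N - 1)) : Fin N := ⟨i.1, by omega⟩

/-- The right site of the `i`-th nearest neighbour pair. -/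
def right {N : ℕ} (i : Fin (N - 1)) : Fin N := ⟨i.1 + 1, by omega⟩

/-- The energy exchange map
`T_{i,α} x = x + [α x_{i+1} - (1-α) x_i] (e_i - e_{i+1})` on `ℝ^N`. -/
def exchangeVec {N : ℕ} (i : Fin (N - 1)) (α : ℝ) (x : Fin N → ℝ) : Fin N → ℝ :=
  x + (α * x (right i) - (1 - α) * x (left i)) •
    (Pi.single (left i) (1 : ℝ) - Pi.single (right i) (1 : ℝ))

theorem exchangeVec_mem {ε : ℝ} {N : ℕ} (i : Fin (N - 1)) (α : unitInterval)
    {x : Fin N → ℝ} (hx : x ∈ simplex ε N) : exchangeVec i α x ∈ simplex ε N := by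
  obtain ⟨h0, h1⟩ := hx
  have hne : left i ≠ right i := by simp [left, right]
  have ha := α.2.1
  have hb := α.2.2
  refine ⟨fun k => ?_, ?_⟩
  · have hl := h0 (left i)
    have hr := h0 (right i)
    by_cases hkl : k = left i
    · subst hkl
      simp only [exchangeVec, Pi.add_apply, Pi.smul_apply, Pi.sub_apply, Pi.single_eq_same,
        Pi.single_eq_of_ne hne, smul_eq_mul]
      nlinarith [mul_nonneg ha hl, mul_nonneg ha hr]
    · by_cases hkr : k = right i
      · subst hkr
        simp only [exchangeVec, Pi.add_apply, Pi.smul_apply, Pi.sub_apply, Pi.single_eq_same,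
          Pi.single_eq_of_ne hne.symm, smul_eq_mul]
        nlinarith [mul_nonneg (sub_nonneg.2 hb) hl, mul_nonneg (sub_nonneg.2 hb) hr]
      · simp only [exchangeVec, Pi.add_apply, Pi.smul_apply, Pi.sub_apply,
          Pi.single_eq_of_ne hkl, Pi.single_eq_of_ne hkr, smul_eq_mul]
        simpa using h0 k
  · rw [← Finset.mul_sum] at h1 ⊢
    rw [← h1]
    congr 1
    simp [exchangeVec, Finset.sum_add_distrib, ← Finset.mul_sum]

/-- The energy exchange map `T_{i,α}` on the invariant set `simplex ε N`. -/
def exchange {ε : ℝ} {N : ℕ} (i : Fin (N - 1)) (α : unitInterval) (x : simplex ε N) :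
    simplex ε N :=
  ⟨exchangeVec i α x.1, exchangeVec_mem i α x.2⟩

/-- The infinitesimal generator
`L A(x) = Λ ∑_i ∫ P(dα) [A(T_{i,α} x) - A(x)]`. -/
def generator {ε : ℝ} {N : ℕ} (Λ : ℝ) (P : Measure unitInterval) (A : simplex ε N → ℝ)
    (x : simplex ε N) : ℝ :=
  Λ * ∑ i : Fin (N - 1), ∫ α, (A (exchange i α x) - A x) ∂P

/-- `κ` is the transition semigroup of a Markov process on `simplex ε N` whose infinitesimal
generator, on the Banach space of bounded Borel functions with the supremum norm, is
`generator Λ P`. -/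
structure IsTransitionSemigroup {ε : ℝ} {N : ℕ} (Λ : ℝ) (P : Measure unitInterval)
    (κ : ℝ≥0 → Kernel (simplex ε N) (simplex ε N)) : Prop where
  markov : ∀ t, IsMarkovKernel (κ t)
  zero : κ 0 = Kernel.id
  add : ∀ s t, κ (s + t) = κ s ∘ₖ κ t
  hasGenerator : ∀ A : simplex ε N → ℝ, Measurable A → (∃ C, ∀ x, |A x| ≤ C) →
    TendstoUniformly (fun (t : ℝ≥0) x => (∫ y, A y ∂(κ t x) - A x) / (t : ℝ))
      (generator Λ P A) (𝓝[>] 0)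

/-- `μ` is stationary for the process with transition semigroup `κ`. -/
def IsStationary {S : Type*} [MeasurableSpace S] (κ : ℝ≥0 → Kernel S S) (μ : Measure S) : Prop :=
  ∀ t, (κ t).Invariant μ

/-- The adapted metric
`d(x,x') = [∑_{i=1}^{N-1} (∑_{k=1}^i (x_k - x'_k))^2]^{1/2}` on `simplex ε N`. -/
def adaptedDist {ε : ℝ} {N : ℕ} (x x' : simplex ε N) : ℝ :=
  √(∑ i : Fin (N - 1), (∑ k ∈ Finset.Iic (left i), (x.1 k - x'.1 k)) ^ 2)

/-- Couplings of two measures. -/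
def Coupling {S : Type*} [MeasurableSpace S] (μ ν : Measure S) : Set (Measure (S × S)) :=
  {Γ | Γ.map Prod.fst = μ ∧ Γ.map Prod.snd = ν}

/-- The Vaserstein-2 distance of two distributions on `simplex ε N` for the adapted metric:
the infimum of `[∫ Γ(dx,dx') d(x,x')^2]^{1/2}` over all couplings `Γ`. -/
def vaserstein2 {ε : ℝ} {N : ℕ} (μ ν : Measure (simplex ε N)) : ℝ :=
  ⨅ Γ : Coupling μ ν, √(∫ z, adaptedDist z.1 z.2 ^ 2 ∂Γ.1)

end EnergyExchange

end

/-! Run two copies of the process with the same bonds and the same splitting ratios, and record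
their difference by its partial sums `D j`, which vanish at `0` and at `N`. An exchange at bond `i`
changes only `D (i+1)`, which becomes `(1-α) D i + α D (i+2)`. The squared adapted distance is the
sum of the squares of the `D j`, so each jump alters a single term of it.

Averaging over `α` and over the bonds, the expected change is a quadratic form in `D` with two-step
differences. A discrete Poincaré inequality (`sin_sq_mul_sum_sq_le_sum_sq_sub`, `sum_update_le`)
bounds it, so that one jump multiplies the expected squared distance by at most `ρ = 1 - (1-4σ²)
sin²(π/(N+2)) / (N-1)` (`integral_cost_pairJumpKernel_le`).

The generator is the bounded operator `Λ(N-1)(Q - 1)`, with `Q` the jump kernel. Running `Q` for a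
Poisson number of steps therefore gives a semigroup, and iterating the forward equation shows that
there is no other (`IsTransitionSemigroup.unique`). The Poisson average of `ρ ^ n` is an exponential
in which `N-1` cancels; the square root in the Vaserstein distance halves the rate.

The simplex is compact, so the laws `Q ^ n` from a fixed point have a limit point; contraction makes
consecutive laws merge, so that limit is invariant (`exists_invariant_of_contraction`). Contraction
also forces uniqueness. -/

noncomputable section

namespace EnergyExchange

/-! ### Discrete Poincaré inequality -/

/-- A two-step discrete Poincaré inequality with Dirichlet boundary conditions on two sites
at either end. -/
theorem sin_sq_mul_sum_sq_le_sum_sq_sub {M : ℕ} {E : ℕ → ℝ} (h0 : E 0 = 0) (h1 : E 1 = 0)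
    (h2 : E (M + 2) = 0) (h3 : E (M + 3) = 0) :
    4 * Real.sin (Real.pi / (M + 3)) ^ 2 * ∑ j ∈ Finset.range M, E (j + 2) ^ 2 ≤
      ∑ j ∈ Finset.range (M + 2), (E (j + 2) - E j) ^ 2 := by
  set θ : ℝ := Real.pi / (M + 3) with hθ
  have hM : (0 : ℝ) < M + 3 := by positivity
  have hθM : (M + 3) * θ = Real.pi := by rw [hθ]; field_simp
  have hθ0 : 0 < θ := by rw [hθ]; positivity
  let w : ℕ → ℝ := fun j => Real.sin (j * θ)
  have hw0 : w 0 = 0 := by simp [w]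
  have hwM : w (M + 3) = 0 := by simp [w, hθM]
  have hw : ∀ j, 0 < j → j < M + 3 → 0 < w j := by
    intro j hj hj'
    apply Real.sin_pos_of_pos_of_lt_pi
    · have : (0 : ℝ) < j := by exact_mod_cast hj
      positivity
    · rw [← hθM]
      have : (j : ℝ) < M + 3 := by exact_mod_cast hj'
      gcongr
  have hwnn : ∀ j, j ≤ M + 3 → 0 ≤ w j := by
    intro j hj
    rcases Nat.eq_zero_or_pos j with rfl | hj0
    · exact hw0.ge
    · rcases hj.lt_or_eq with h | rfl
      · exact (hw j hj0 h).le
      · exact hwM.ge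
  have hrec : ∀ j, w (j + 4) + w j = (2 - 4 * Real.sin θ ^ 2) * w (j + 2) := by
    intro j
    have e1 : ((j + 4 : ℕ) : ℝ) * θ = (j + 2 : ℕ) * θ + 2 * θ := by push_cast; ring
    have e2 : (j : ℝ) * θ = (j + 2 : ℕ) * θ - 2 * θ := by push_cast; ring
    simp only [w]
    rw [e1, e2, Real.sin_add, Real.sin_sub, Real.cos_two_mul, Real.cos_sq']
    ring
  -- Picone's identity with the positive ground state `w`: away from the ends the defect is a square
  -- over `w j * w (j + 2)`. At the two ends `w` vanishes together with `E`, and division by zero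
  -- being zero gives equality.
  have key : ∀ j ∈ Finset.range (M + 2),
      E j ^ 2 * (1 - w (j + 2) / w j) + E (j + 2) ^ 2 * (1 - w j / w (j + 2)) ≤
        (E (j + 2) - E j) ^ 2 := by
    intro j hj
    have hjM : j < M + 2 := Finset.mem_range.1 hj
    rcases Nat.eq_zero_or_pos j with rfl | hj0
    · simp [h0, hw0]
    · rcases Nat.lt_or_ge (j + 2) (M + 3) with hlt | hge
      · have ha := hw j hj0 (by omega)
        have hb := hw (j + 2) (by omega) hlt
        set a := w j
        set b := w (j + 2)
        have : (E (j + 2) - E j) ^ 2 -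
            (E j ^ 2 * (1 - b / a) + E (j + 2) ^ 2 * (1 - a / b)) =
            (E j * b - E (j + 2) * a) ^ 2 / (a * b) := by
          field_simp
          ring
        have h' : 0 ≤ (E j * b - E (j + 2) * a) ^ 2 / (a * b) := by positivity
        linarith
      · have : j = M + 1 := by omega
        subst this
        have e : M + 1 + 2 = M + 3 := rfl
        rw [e, h3, hwM]
        simp
  -- After summation the coefficient of `E (j+2) ^ 2` is `2 - (w (j+4) + w j) / w (j+2)`, which is
  -- `4 sin² θ` by `hrec`.
  refine le_trans (le_of_eq ?_) (Finset.sum_le_sum key)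
  rw [Finset.sum_add_distrib, Finset.sum_range_succ', Finset.sum_range_succ',
    Finset.sum_range_succ (fun j => E (j + 2) ^ 2 * (1 - w j / w (j + 2))),
    Finset.sum_range_succ (fun j => E (j + 2) ^ 2 * (1 - w j / w (j + 2)))]
  have e : M + 1 + 2 = M + 3 := rfl
  simp only [e, h0, h1, h2, h3, zero_add, ne_eq, OfNat.ofNat_ne_zero, not_false_eq_true, zero_pow,
    zero_mul, add_zero]
  rw [← Finset.sum_add_distrib, Finset.mul_sum]
  refine Finset.sum_congr rfl fun j hj => ?_
  have hb := hw (j + 2) (by omega) (by have := Finset.mem_range.1 hj; omega)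
  have := hrec j
  have e4 : j + 1 + 1 = j + 2 := rfl
  have e5 : j + 2 + 2 = j + 4 := rfl
  rw [e4, e5]
  field_simp
  rw [eq_sub_iff_add_eq.2 this]
  ring

/-- The averaged one-site updates contract the squared Euclidean norm of a sequence that vanishes
at both ends. -/
theorem sum_update_le {M : ℕ} {D : ℕ → ℝ} (h0 : D 0 = 0) (h1 : D (M + 1) = 0) {c : ℝ}
    (hc : 0 ≤ c) (hc' : c ≤ 1 / 4) :
    ∑ j ∈ Finset.range M,
        (1 / 2 * (D j ^ 2 + D (j + 2) ^ 2) - c * (D (j + 2) - D j) ^ 2 - D (j + 1) ^ 2) ≤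
      -(4 * c * Real.sin (Real.pi / (M + 3)) ^ 2 * ∑ j ∈ Finset.range M, D (j + 1) ^ 2) := by
  -- Steps of length two separate the parities, and each parity class needs a zero at both ends.
  -- Hence a second zero is added at each end; truncated subtraction supplies `E 0 = D 0`. The price
  -- is the boundary terms `D 1 ^ 2` and `D M ^ 2`, which the averages on the left-hand side pay
  -- for, since they lose half of each and `c ≤ 1/4`.
  let E : ℕ → ℝ := fun j => if j = M + 3 then 0 else D (j - 1)
  have hE : ∀ j < M + 3, E j = D (j - 1) := fun j hj => if_neg hj.ne
  have hp := sin_sq_mul_sum_sq_le_sum_sq_sub (M := M) (E := E)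
    (by rw [hE _ (by omega)]; exact h0) (by rw [hE _ (by omega)]; exact h0)
    (by rw [hE _ (by omega)]; exact h1) (if_pos rfl)
  rw [Finset.sum_range_succ, Finset.sum_range_succ'] at hp
  have s1 : ∑ j ∈ Finset.range M, E (j + 2) ^ 2 = ∑ j ∈ Finset.range M, D (j + 1) ^ 2 :=
    Finset.sum_congr rfl fun j hj => by
      rw [hE _ (by have := Finset.mem_range.1 hj; omega)]; rfl
  have s2 : ∑ j ∈ Finset.range M, (E (j + 1 + 2) - E (j + 1)) ^ 2 =
      ∑ j ∈ Finset.range M, (D (j + 2) - D j) ^ 2 :=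
    Finset.sum_congr rfl fun j hj => by
      have := Finset.mem_range.1 hj
      rw [hE _ (by omega), hE _ (by omega)]; rfl
  have s3 : E (0 + 2) - E 0 = D 1 := by
    rw [hE _ (by omega), hE _ (by omega)]; simp [h0]
  have s4 : E (M + 1 + 2) - E (M + 1) = - D M := by
    rw [hE (M + 1) (by omega)]; simp [E]
  rw [s1, s2, s3, s4] at hp
  have t1 : ∑ j ∈ Finset.range M, D j ^ 2 + D M ^ 2 = ∑ j ∈ Finset.range M, D (j + 1) ^ 2 := by
    rw [← Finset.sum_range_succ, Finset.sum_range_succ' (fun j => D j ^ 2)]; simp [h0]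
  have t2 : ∑ j ∈ Finset.range M, D (j + 2) ^ 2 + D 1 ^ 2 =
      ∑ j ∈ Finset.range M, D (j + 1) ^ 2 := by
    have := (Finset.sum_range_succ' (fun j => D (j + 1) ^ 2) M).symm.trans
      (Finset.sum_range_succ (fun j => D (j + 1) ^ 2) M)
    simpa [h1] using this
  rw [Finset.sum_sub_distrib, Finset.sum_sub_distrib, ← Finset.mul_sum, ← Finset.mul_sum,
    Finset.sum_add_distrib]
  have hp' := mul_le_mul_of_nonneg_left hp hc
  nlinarith [mul_nonneg (sub_nonneg.2 hc') (sq_nonneg (D 1)),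
    mul_nonneg (sub_nonneg.2 hc') (sq_nonneg (D M)), sq_nonneg (D 1), sq_nonneg (D M)]

/-! ### Poissonized Markov chains -/

section Poissonization

variable {S : Type*} [MeasurableSpace S]

theorem integrable_of_abs_le {μ : Measure S} [IsFiniteMeasure μ] {A : S → ℝ} (hA : Measurable A)
    {C : ℝ} (hC : ∀ x, |A x| ≤ C) : Integrable A μ :=
  Integrable.of_bound hA.aestronglyMeasurable C (ae_of_all _ fun x => hC x)

theorem abs_integral_le_of_abs_le {μ : Measure S} [IsProbabilityMeasure μ] {A : S → ℝ} {C : ℝ}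
    (hC : ∀ x, |A x| ≤ C) : |∫ x, A x ∂μ| ≤ C := by
  have h := norm_integral_le_of_norm_le_const (μ := μ) (f := A) (ae_of_all _ hC)
  simpa using h

theorem measurable_integral_kernel {T : Type*} [MeasurableSpace T] (κ : Kernel S T)
    [IsSFiniteKernel κ] {A : T → ℝ} (hA : Measurable A) : Measurable fun x => ∫ y, A y ∂(κ x) :=
  (hA.stronglyMeasurable.integral_kernel (κ := κ)).measurable

theorem integral_bind_kernel {T : Type*} [MeasurableSpace T] (μ : Measure S) [IsFiniteMeasure μ]
    (κ : Kernel S T) [IsMarkovKernel κ] {A : T → ℝ} (hA : Measurable A) {C : ℝ}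
    (hC : ∀ x, |A x| ≤ C) : ∫ y, A y ∂(μ.bind κ) = ∫ x, ∫ y, A y ∂(κ x) ∂μ := by
  rw [Measure.comp_eq_comp_const_apply, Kernel.integral_comp (integrable_of_abs_le hA hC)]
  simp

instance isMarkovKernel_pow (Q : Kernel S S) [IsMarkovKernel Q] (n : ℕ) :
    IsMarkovKernel (Q ^ n) := by
  induction n with
  | zero => rw [pow_zero]; exact inferInstanceAs (IsMarkovKernel Kernel.id)
  | succ n ih => rw [pow_succ]; exact inferInstanceAs (IsMarkovKernel ((Q ^ n) ∘ₖ Q))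

/-- The law after `n` steps as a kernel in the number of steps. -/
def stepKernel (Q : Kernel S S) (x : S) : Kernel ℕ S := ⟨fun n => (Q ^ n) x, .of_discrete⟩

theorem stepKernel_apply (Q : Kernel S S) (x : S) (n : ℕ) : stepKernel Q x n = (Q ^ n) x := rfl

instance (Q : Kernel S S) [IsMarkovKernel Q] (x : S) : IsMarkovKernel (stepKernel Q x) :=
  ⟨fun n => by rw [stepKernel_apply]; infer_instance⟩

theorem bind_stepKernel_apply (Q : Kernel S S) (r : ℝ≥0) (x : S) {s : Set S}
    (hs : MeasurableSet s) :
    (poissonMeasure r).bind (stepKernel Q x) s = ∫⁻ n, (Q ^ n) x s ∂(poissonMeasure r) :=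
  Measure.bind_apply hs (Kernel.aemeasurable _)

/-- The law of a Markov chain with transition kernel `Q` after a Poisson number of steps. -/
def poissonizedKernel (Q : Kernel S S) (r : ℝ≥0) : Kernel S S where
  toFun x := (poissonMeasure r).bind (stepKernel Q x)
  measurable' := by
    refine Measure.measurable_of_measurable_coe _ fun s hs => ?_
    simp_rw [bind_stepKernel_apply Q r _ hs, lintegral_countable']
    exact Measurable.tsum fun n => ((Q ^ n).measurable_coe hs).mul_const _

theorem poissonizedKernel_apply (Q : Kernel S S) (r : ℝ≥0) (x : S) :
    poissonizedKernel Q r x = (poissonMeasure r).bind (stepKernel Q x) := rfl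

instance (Q : Kernel S S) [IsMarkovKernel Q] (r : ℝ≥0) : IsMarkovKernel (poissonizedKernel Q r) :=
  ⟨fun x => by rw [poissonizedKernel_apply]; infer_instance⟩

theorem poissonizedKernel_apply' (Q : Kernel S S) (r : ℝ≥0) (x : S) {s : Set S}
    (hs : MeasurableSet s) :
    poissonizedKernel Q r x s = ∫⁻ n, (Q ^ n) x s ∂(poissonMeasure r) :=
  bind_stepKernel_apply Q r x hs

theorem integral_poissonizedKernel (Q : Kernel S S) [IsMarkovKernel Q] (r : ℝ≥0) (x : S)
    {A : S → ℝ} (hA : Measurable A) {C : ℝ} (hC : ∀ x, |A x| ≤ C) :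
    ∫ y, A y ∂(poissonizedKernel Q r x) = ∫ n, ∫ y, A y ∂((Q ^ n) x) ∂(poissonMeasure r) := by
  rw [poissonizedKernel_apply, integral_bind_kernel _ _ hA hC]
  rfl

theorem poissonizedKernel_zero (Q : Kernel S S) : poissonizedKernel Q 0 = Kernel.id := by
  ext x s hs
  rw [poissonizedKernel_apply' Q 0 x hs, lintegral_countable', tsum_eq_single 0]
  · rw [poissonMeasure_singleton, pow_zero]
    simp only [NNReal.coe_zero, neg_zero, Real.exp_zero, pow_zero, mul_one, Nat.factorial_zero,
      Nat.cast_one, div_one, ENNReal.ofReal_one]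
    rfl
  · intro n hn
    rw [poissonMeasure_singleton]
    simp [hn]

/-- Independent Poisson variables add to a Poisson variable, and `Q ^ (m + k)` splits by
Chapman–Kolmogorov. -/
theorem poissonizedKernel_add (Q : Kernel S S) [IsMarkovKernel Q] (s t : ℝ≥0) :
    poissonizedKernel Q (s + t) = poissonizedKernel Q s ∘ₖ poissonizedKernel Q t := by
  ext x B hB
  rw [Kernel.comp_apply' _ _ _ hB, poissonizedKernel_apply' Q _ x hB,
    poissonizedKernel_apply Q t, Measure.lintegral_bind (Kernel.aemeasurable _)
      (Kernel.measurable_coe _ hB).aemeasurable, add_comm s t,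
    ← poissonMeasure_conv_poissonMeasure, Measure.lintegral_conv .of_discrete]
  refine lintegral_congr fun k => ?_
  simp_rw [poissonizedKernel_apply' Q s _ hB]
  rw [lintegral_lintegral_swap]
  · refine lintegral_congr fun m => ?_
    rw [stepKernel_apply, Kernel.pow_add_apply_eq_lintegral _ _ _ _ hB]
  · refine Measurable.aemeasurable ?_
    exact measurable_from_prod_countable_left fun m => (Q ^ m).measurable_coe hB

theorem integral_poissonMeasure_pow (r : ℝ≥0) {ρ : ℝ} :
    ∫ n, ρ ^ n ∂(poissonMeasure r) = Real.exp (-((1 - ρ) * r)) := by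
  rw [integral_poissonMeasure]
  have h := (NormedSpace.expSeries_div_hasSum_exp ((r : ℝ) * ρ)).mul_left (Real.exp (-r))
  rw [← Real.exp_eq_exp_ℝ, ← Real.exp_add] at h
  refine (Eq.trans ?_ h.tsum_eq).trans (by ring_nf)
  refine tsum_congr fun n => ?_
  rw [smul_eq_mul, mul_pow]
  ring

theorem integrable_poissonMeasure_pow (r : ℝ≥0) {ρ : ℝ} (hρ : 0 ≤ ρ) (hρ' : ρ ≤ 1) :
    Integrable (fun n : ℕ => ρ ^ n) (poissonMeasure r) :=
  integrable_of_abs_le (C := 1) .of_discrete fun n => by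
    rw [abs_of_nonneg (pow_nonneg hρ n)]; exact pow_le_one₀ hρ hρ'

/-- Only zero or one jump matters to first order. With `q = exp (-r)`, the errors are the mass `1 -
q - q r` of two or more jumps, `q - 1 + r` and `r (1 - q)`; each is at most `r ^ 2`, whence the
factor `3`. The bound is uniform in `x`, as the generator in supremum norm requires. -/
theorem abs_integral_poissonizedKernel_sub_le (Q : Kernel S S) [IsMarkovKernel Q] {r : ℝ≥0}
    (hr : r ≤ 1) (x : S) {A : S → ℝ} (hA : Measurable A) {C : ℝ} (hC : ∀ x, |A x| ≤ C) :
    |∫ y, A y ∂(poissonizedKernel Q r x) - A x - r * (∫ y, A y ∂(Q x) - A x)| ≤ 3 * C * r ^ 2 := by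
  set a : ℕ → ℝ := fun n => ∫ y, A y ∂((Q ^ n) x) with ha
  have hbound : ∀ n, |a n| ≤ C := fun n => abs_integral_le_of_abs_le hC
  have ha0 : a 0 = A x := by
    have : (Q ^ 0) x = Measure.dirac x := by
      rw [pow_zero]; exact Kernel.id_apply x
    simp only [ha, this]
    exact integral_dirac' _ _ hA.stronglyMeasurable
  have ha1 : a 1 = ∫ y, A y ∂(Q x) := by simp only [ha, pow_one]
  set p : ℕ → ℝ := fun n => Real.exp (-r) * r ^ n / n.factorial with hp
  have hp0 : ∀ n, 0 ≤ p n := fun n => by simp only [hp]; positivity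
  have hsum : HasSum (fun n => p n * a n) (∫ y, A y ∂(poissonizedKernel Q r x)) := by
    rw [integral_poissonizedKernel Q r x hA hC]
    exact hasSum_integral_poissonMeasure (integrable_of_abs_le .of_discrete hbound)
  have hone : HasSum p 1 := hasSum_one_poissonMeasure r
  have hsum' := (hasSum_nat_add_iff' 2).2 hsum
  have hone' := ((hasSum_nat_add_iff' 2).2 hone).mul_left C
  have htail : |∫ y, A y ∂(poissonizedKernel Q r x) - (p 0 * a 0 + p 1 * a 1)| ≤
      C * (1 - (p 0 + p 1)) := by
    have := tsum_of_norm_bounded hone' (f := fun n => p (n + 2) * a (n + 2)) fun n => by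
      rw [norm_mul, Real.norm_of_nonneg (hp0 _), mul_comm]
      exact mul_le_mul_of_nonneg_right (hbound _) (hp0 _)
    rw [hsum'.tsum_eq] at this
    simpa [Finset.sum_range_succ] using this
  have hr0 : (0 : ℝ) ≤ r := r.2
  have hr1 : (r : ℝ) ≤ 1 := by exact_mod_cast hr
  have e0 : p 0 = Real.exp (-r) := by simp [hp]
  have e1 : p 1 = Real.exp (-r) * r := by simp [hp]
  have hexp := Real.abs_exp_sub_one_sub_id_le (x := -(r : ℝ)) (by rwa [abs_neg, abs_of_nonneg hr0])
  have hexp1 : 1 - (r : ℝ) ≤ Real.exp (-r) := by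
    have := Real.add_one_le_exp (-(r : ℝ)); linarith
  have hexp2 : Real.exp (-(r : ℝ)) ≤ 1 := Real.exp_le_one_iff.2 (by linarith)
  rw [← ha0, ← ha1]
  rw [e0, e1] at htail
  set q := Real.exp (-(r : ℝ))
  set I := ∫ y, A y ∂(poissonizedKernel Q r x)
  have hq : q - 1 + r ≤ r ^ 2 := by
    have := (abs_le.1 hexp).2; nlinarith
  have hC0 : 0 ≤ C := (abs_nonneg _).trans (hbound 0)
  have hdecomp : I - a 0 - r * (a 1 - a 0) =
      (I - (q * a 0 + q * r * a 1)) + (q - 1 + r) * a 0 - r * (1 - q) * a 1 := by ring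
  rw [hdecomp]
  have b1 : |(q - 1 + r) * a 0| ≤ (q - 1 + r) * C := by
    rw [abs_mul, abs_of_nonneg (by linarith : (0 : ℝ) ≤ q - 1 + r)]
    exact mul_le_mul_of_nonneg_left (hbound 0) (by linarith)
  have b2 : |r * (1 - q) * a 1| ≤ r * (1 - q) * C := by
    have : 0 ≤ r * (1 - q) := mul_nonneg hr0 (by linarith)
    rw [abs_mul, abs_of_nonneg this]
    exact mul_le_mul_of_nonneg_left (hbound 1) this
  refine (abs_sub _ _).trans ((add_le_add_left (abs_add_le _ _) _).trans ?_)
  have hrq : r * (1 - q) ≤ r ^ 2 := by nlinarith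
  have f1 := mul_le_mul_of_nonneg_left hq hC0
  have f2 := mul_le_mul_of_nonneg_left hrq hC0
  have f3 : C * (1 - (q + q * r)) ≤ C * r ^ 2 := by
    apply mul_le_mul_of_nonneg_left _ hC0
    nlinarith
  linarith

theorem tendstoUniformly_poissonizedKernel (Q : Kernel S S) [IsMarkovKernel Q] (lam : ℝ≥0)
    {A : S → ℝ} (hA : Measurable A) {C : ℝ} (hC : ∀ x, |A x| ≤ C) :
    TendstoUniformly
      (fun (t : ℝ≥0) x => (∫ y, A y ∂(poissonizedKernel Q (lam * t) x) - A x) / (t : ℝ))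
      (fun x => lam * (∫ y, A y ∂(Q x) - A x)) (𝓝[>] 0) := by
  rw [Metric.tendstoUniformly_iff]
  intro e he
  have h1 : ∀ᶠ t : ℝ≥0 in 𝓝[>] 0, lam * t ≤ 1 := by
    have : Tendsto (fun t : ℝ≥0 => lam * t) (𝓝 0) (𝓝 (lam * 0)) := tendsto_id.const_mul lam
    rw [mul_zero] at this
    exact nhdsWithin_le_nhds (this.eventually (eventually_le_nhds zero_lt_one))
  have h2 : ∀ᶠ t : ℝ≥0 in 𝓝[>] 0, 3 * C * lam ^ 2 * (t : ℝ) < e := by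
    have : Tendsto (fun t : ℝ≥0 => 3 * C * lam ^ 2 * (t : ℝ)) (𝓝 0)
        (𝓝 (3 * C * lam ^ 2 * ((0 : ℝ≥0) : ℝ))) :=
      (NNReal.continuous_coe.tendsto 0).const_mul _
    rw [NNReal.coe_zero, mul_zero] at this
    exact nhdsWithin_le_nhds (this.eventually (eventually_lt_nhds he))
  filter_upwards [h1, h2, self_mem_nhdsWithin] with t ht1 ht2 ht0 x
  have ht : (0 : ℝ) < t := by exact_mod_cast ht0
  have h := abs_integral_poissonizedKernel_sub_le Q ht1 x hA hC
  refine lt_of_le_of_lt ?_ ht2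
  rw [dist_comm, Real.dist_eq]
  push_cast at h
  have e1 : (∫ y, A y ∂(poissonizedKernel Q (lam * t) x) - A x) / (t : ℝ) -
      lam * (∫ y, A y ∂(Q x) - A x) = (∫ y, A y ∂(poissonizedKernel Q (lam * t) x) - A x -
      lam * t * (∫ y, A y ∂(Q x) - A x)) / t := by
    field_simp
  rw [e1, abs_div, abs_of_pos ht, div_le_iff₀ ht]
  refine h.trans (le_of_eq ?_)
  ring

theorem invariant_pow {Q : Kernel S S} {μ : Measure S} (h : Q.Invariant μ) (n : ℕ) :
    (Q ^ n).Invariant μ := by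
  induction n with
  | zero => rw [pow_zero]; exact Measure.bind_dirac
  | succ n ih => rw [pow_succ]; exact ih.comp h

theorem invariant_poissonizedKernel {Q : Kernel S S} {μ : Measure S} [SFinite μ] (h : Q.Invariant μ)
    (r : ℝ≥0) : (poissonizedKernel Q r).Invariant μ := by
  ext s hs
  rw [Measure.bind_apply hs (Kernel.aemeasurable _)]
  simp_rw [poissonizedKernel_apply' Q r _ hs]
  rw [lintegral_lintegral_swap]
  · have : ∀ n, ∫⁻ x, (Q ^ n) x s ∂μ = μ s := fun n => by
      rw [← Measure.bind_apply hs (Kernel.aemeasurable _), (invariant_pow h n).def]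
    simp [this]
  · exact (measurable_from_prod_countable_left fun m => (Q ^ m).measurable_coe hs).aemeasurable

end Poissonization

/-! ### Markovian couplings and contraction of a cost -/

section Contraction

variable {S T : Type*} [MeasurableSpace S] [MeasurableSpace T]

/-- The hypothesis says that `f` projects the chain `Q'` onto the chain `Q`. With `f` either
coordinate projection it says that `Q'` couples `Q` with itself, a property that passes to powers
and Poisson mixtures. -/
theorem bind_map_of_intertwined {Q' : Kernel T T} {Q : Kernel S S} {f : T → S}
    (hf : Measurable f) (h : ∀ z, (Q' z).map f = Q (f z)) (Γ : Measure T) :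
    (Γ.bind Q').map f = (Γ.map f).bind Q := by
  ext s hs
  rw [Measure.map_apply hf hs, Measure.bind_apply (hf hs) (Kernel.aemeasurable _),
    Measure.bind_apply hs (Kernel.aemeasurable _), lintegral_map (Q.measurable_coe hs) hf]
  refine lintegral_congr fun z => ?_
  rw [← h z, Measure.map_apply hf hs]

theorem pow_map_of_intertwined {Q' : Kernel T T} {Q : Kernel S S} {f : T → S}
    (hf : Measurable f) (h : ∀ z, (Q' z).map f = Q (f z)) (n : ℕ) (z : T) :
    ((Q' ^ n) z).map f = (Q ^ n) (f z) := by
  induction n generalizing z with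
  | zero =>
    rw [pow_zero, pow_zero]
    exact Measure.map_dirac' hf z
  | succ n ih =>
    rw [pow_succ, pow_succ]
    change ((Q' z).bind (Q' ^ n)).map f = (Q (f z)).bind (Q ^ n)
    rw [bind_map_of_intertwined hf ih, h]

theorem poissonizedKernel_map_of_intertwined {Q' : Kernel T T} {Q : Kernel S S} {f : T → S}
    (hf : Measurable f) (h : ∀ z, (Q' z).map f = Q (f z)) (r : ℝ≥0) (z : T) :
    (poissonizedKernel Q' r z).map f = poissonizedKernel Q r (f z) := by
  ext s hs
  rw [Measure.map_apply hf hs, poissonizedKernel_apply' Q' r z (hf hs),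
    poissonizedKernel_apply' Q r _ hs]
  refine lintegral_congr fun n => ?_
  rw [← pow_map_of_intertwined hf h n z, Measure.map_apply hf hs]

theorem bind_mem_coupling {Q' : Kernel (S × S) (S × S)} {Q : Kernel S S}
    (h1 : ∀ z, (Q' z).map Prod.fst = Q z.1) (h2 : ∀ z, (Q' z).map Prod.snd = Q z.2)
    {μ ν : Measure S} {Γ : Measure (S × S)} (hΓ : Γ ∈ Coupling μ ν) :
    Γ.bind Q' ∈ Coupling (μ.bind Q) (ν.bind Q) := by
  constructor
  · rw [bind_map_of_intertwined measurable_fst h1, hΓ.1]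
  · rw [bind_map_of_intertwined measurable_snd h2, hΓ.2]

theorem isProbabilityMeasure_of_mem_coupling {μ ν : Measure S} [IsProbabilityMeasure μ]
    {Γ : Measure (S × S)} (hΓ : Γ ∈ Coupling μ ν) : IsProbabilityMeasure Γ := by
  have h : IsProbabilityMeasure (Γ.map Prod.fst) := by rw [hΓ.1]; infer_instance
  exact (Measure.isProbabilityMeasure_map_iff measurable_fst.aemeasurable).1 h

theorem prod_mem_coupling (μ ν : Measure S) [IsProbabilityMeasure μ] [IsProbabilityMeasure ν] :
    μ.prod ν ∈ Coupling μ ν :=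
  ⟨by simp [Measure.map_fst_prod], by simp [Measure.map_snd_prod]⟩

variable {Q : Kernel T T} [IsMarkovKernel Q] {c : T → ℝ} {B ρ : ℝ}

theorem integral_pow_le_of_contraction (hc : Measurable c) (hB : ∀ z, |c z| ≤ B) (hρ : 0 ≤ ρ)
    (h : ∀ z, ∫ w, c w ∂(Q z) ≤ ρ * c z) (n : ℕ) (z : T) :
    ∫ w, c w ∂((Q ^ n) z) ≤ ρ ^ n * c z := by
  induction n generalizing z with
  | zero =>
    rw [pow_zero, pow_zero, one_mul]
    exact (integral_dirac' _ _ hc.stronglyMeasurable).le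
  | succ n ih =>
    rw [pow_succ]
    change ∫ w, c w ∂((Q z).bind (Q ^ n)) ≤ _
    rw [integral_bind_kernel _ _ hc hB]
    calc ∫ w, ∫ y, c y ∂((Q ^ n) w) ∂(Q z)
        ≤ ∫ w, ρ ^ n * c w ∂(Q z) := by
          refine integral_mono ?_ ((integrable_of_abs_le hc hB).const_mul _) ih
          exact integrable_of_abs_le (measurable_integral_kernel _ hc)
            fun x => abs_integral_le_of_abs_le hB
      _ = ρ ^ n * ∫ w, c w ∂(Q z) := integral_const_mul _ _
      _ ≤ ρ ^ n * (ρ * c z) := mul_le_mul_of_nonneg_left (h z) (pow_nonneg hρ n)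
      _ = ρ ^ (n + 1) * c z := by ring

/-- The Poisson generating function at `ρ` converts the factor `ρ ^ n` after `n` jumps into an
exponential. -/
theorem integral_poissonizedKernel_le_of_contraction (hc : Measurable c) (hB : ∀ z, |c z| ≤ B)
    (hρ : 0 ≤ ρ) (hρ' : ρ ≤ 1) (h : ∀ z, ∫ w, c w ∂(Q z) ≤ ρ * c z) (r : ℝ≥0) (z : T) :
    ∫ w, c w ∂(poissonizedKernel Q r z) ≤ Real.exp (-((1 - ρ) * r)) * c z := by
  rw [integral_poissonizedKernel Q r z hc hB, ← integral_poissonMeasure_pow, ← integral_mul_const]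
  refine integral_mono ?_ ((integrable_poissonMeasure_pow r hρ hρ').mul_const _)
    fun n => integral_pow_le_of_contraction hc hB hρ h n z
  exact integrable_of_abs_le .of_discrete fun n => abs_integral_le_of_abs_le hB

theorem integral_bind_le_of_contraction (hc : Measurable c) (hB : ∀ z, |c z| ≤ B)
    (h : ∀ z, ∫ w, c w ∂(Q z) ≤ ρ * c z) (Γ : Measure T) [IsFiniteMeasure Γ] :
    ∫ w, c w ∂(Γ.bind Q) ≤ ρ * ∫ w, c w ∂Γ := by
  rw [integral_bind_kernel _ _ hc hB, ← integral_const_mul]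
  refine integral_mono ?_ ((integrable_of_abs_le hc hB).const_mul _) h
  exact integrable_of_abs_le (measurable_integral_kernel _ hc)
    fun x => abs_integral_le_of_abs_le hB

end Contraction

/-! ### Invariant measures on a compact space -/

section Ergodicity

variable {S : Type*} [TopologicalSpace S]

/-- On a compact space every continuous function has a modulus of continuity that is affine in a
given continuous cost vanishing only on the diagonal. -/
theorem exists_abs_sub_le_add_mul [CompactSpace S] {c : S × S → ℝ} (hc : Continuous c) (hc0 : ∀ z, 0 ≤ c z)
    (hcd : ∀ z, c z = 0 → z.1 = z.2) {A : S → ℝ} (hA : Continuous A) {δ : ℝ} (hδ : 0 < δ) :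
    ∃ C, 0 ≤ C ∧ ∀ z : S × S, |A z.1 - A z.2| ≤ δ + C * c z := by
  have hF : Continuous fun z : S × S => |A z.1 - A z.2| := by fun_prop
  -- On this compact set off the diagonal the cost has a positive minimum, so `C` can be the maximal
  -- oscillation of `A` divided by it.
  let K : Set (S × S) := {z | δ ≤ |A z.1 - A z.2|}
  have hK : IsCompact K := (isClosed_le continuous_const hF).isCompact
  rcases K.eq_empty_or_nonempty with hKe | hKn
  · refine ⟨0, le_rfl, fun z => ?_⟩
    have : z ∉ K := by simp [hKe]
    rw [zero_mul, add_zero]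
    exact (not_le.1 this).le
  · obtain ⟨z₀, hz₀, hmin⟩ := hK.exists_isMinOn hKn hc.continuousOn
    obtain ⟨z₁, -, hmax⟩ := hK.exists_isMaxOn hKn hF.continuousOn
    have hpos : 0 < c z₀ := by
      refine lt_of_le_of_ne (hc0 _) fun h => ?_
      have h' : δ ≤ |A z₀.1 - A z₀.2| := hz₀
      rw [hcd z₀ h.symm, sub_self, abs_zero] at h'
      linarith
    refine ⟨|A z₁.1 - A z₁.2| / c z₀, by positivity, fun z => ?_⟩
    by_cases hz : z ∈ K
    · have h1 : |A z.1 - A z.2| ≤ |A z₁.1 - A z₁.2| := hmax hz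
      have h2 : c z₀ ≤ c z := hmin hz
      calc |A z.1 - A z.2| ≤ |A z₁.1 - A z₁.2| / c z₀ * c z₀ := by
            rwa [div_mul_cancel₀ _ hpos.ne']
        _ ≤ |A z₁.1 - A z₁.2| / c z₀ * c z := by gcongr
        _ ≤ _ := by linarith
    · have h1 : |A z.1 - A z.2| < δ := not_le.1 hz
      have : 0 ≤ |A z₁.1 - A z₁.2| / c z₀ * c z := mul_nonneg (by positivity) (hc0 z)
      linarith

variable [MeasurableSpace S] [BorelSpace S]

theorem abs_integral_sub_integral_le_of_coupling {c : S × S → ℝ} (hc : Measurable c) {B : ℝ}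
    (hB : ∀ z, |c z| ≤ B) (A : BoundedContinuousFunction S ℝ) {δ C : ℝ}
    (hC : ∀ z : S × S, |A z.1 - A z.2| ≤ δ + C * c z) {μ ν : Measure S} [IsProbabilityMeasure μ]
    {Γ : Measure (S × S)} (hΓ : Γ ∈ Coupling μ ν) :
    |∫ x, A x ∂μ - ∫ x, A x ∂ν| ≤ δ + C * ∫ z, c z ∂Γ := by
  have := isProbabilityMeasure_of_mem_coupling hΓ
  have hA : Measurable A := A.continuous.measurable
  have hAb : ∀ x, |A x| ≤ ‖A‖ := fun x => A.norm_coe_le_norm x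
  rw [← hΓ.1, ← hΓ.2, integral_map measurable_fst.aemeasurable hA.aestronglyMeasurable,
    integral_map measurable_snd.aemeasurable hA.aestronglyMeasurable, ← integral_sub]
  · calc |∫ z, (A z.1 - A z.2) ∂Γ| ≤ ∫ z, |A z.1 - A z.2| ∂Γ := abs_integral_le_integral_abs
      _ ≤ ∫ z, (δ + C * c z) ∂Γ := by
        refine integral_mono ?_ ?_ hC
        · refine integrable_of_abs_le (C := ‖A‖ + ‖A‖)
            ((hA.comp measurable_fst).sub (hA.comp measurable_snd)).abs fun z => ?_
          rw [abs_abs]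
          exact (abs_sub _ _).trans (add_le_add (hAb _) (hAb _))
        · exact (integrable_const _).add ((integrable_of_abs_le hc hB).const_mul _)
      _ = δ + C * ∫ z, c z ∂Γ := by
        rw [integral_add (integrable_const _) ((integrable_of_abs_le hc hB).const_mul _),
          integral_const_mul]
        simp
  · exact integrable_of_abs_le (hA.comp measurable_fst) fun z => hAb _
  · exact integrable_of_abs_le (hA.comp measurable_snd) fun z => hAb _

variable [CompactSpace S] [HasOuterApproxClosed S] {c : S × S → ℝ} {B : ℝ}

/-- Couplings of small cost make the integrals of every continuous function nearly equal, and these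
integrals determine a finite measure. -/
theorem eq_of_forall_exists_coupling_le (hc : Continuous c) (hcm : Measurable c)
    (hc0 : ∀ z, 0 ≤ c z) (hcd : ∀ z, c z = 0 → z.1 = z.2) (hB : ∀ z, |c z| ≤ B)
    {μ ν : Measure S} [IsProbabilityMeasure μ] [IsProbabilityMeasure ν]
    (h : ∀ η > 0, ∃ Γ ∈ Coupling μ ν, ∫ z, c z ∂Γ ≤ η) : μ = ν := by
  refine ext_of_forall_integral_eq_of_IsFiniteMeasure fun A => ?_
  refine eq_of_abs_sub_le_all fun e he => ?_
  obtain ⟨C, hC0, hC⟩ := exists_abs_sub_le_add_mul hc hc0 hcd A.continuous (half_pos he)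
  obtain ⟨Γ, hΓ, hη⟩ := h (e / (2 * (C + 1))) (by positivity)
  refine (abs_integral_sub_integral_le_of_coupling hcm hB A hC hΓ).trans ?_
  have : C * ∫ z, c z ∂Γ ≤ e / 2 := by
    calc C * ∫ z, c z ∂Γ ≤ (C + 1) * (e / (2 * (C + 1))) := by
          gcongr
          · exact integral_nonneg hc0
          · linarith
      _ = e / 2 := by field_simp
  linarith

/-- A Feller kernel on a compact space that contracts a cost along a coupling has an invariant
probability measure. -/
theorem exists_invariant_of_contraction [T2Space S] [Nonempty S] (hc : Continuous c)
    (hcm : Measurable c)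
    (hc0 : ∀ z, 0 ≤ c z) (hcd : ∀ z, c z = 0 → z.1 = z.2) (hB : ∀ z, |c z| ≤ B)
    {Q : Kernel S S} [IsMarkovKernel Q] (hQ : ∀ A : S → ℝ, Continuous A →
      Continuous fun x => ∫ y, A y ∂(Q x))
    {Q' : Kernel (S × S) (S × S)} [IsMarkovKernel Q']
    (h1 : ∀ z, (Q' z).map Prod.fst = Q z.1) (h2 : ∀ z, (Q' z).map Prod.snd = Q z.2)
    {ρ : ℝ} (hρ : 0 ≤ ρ) (hρ' : ρ < 1) (h : ∀ z, ∫ w, c w ∂(Q' z) ≤ ρ * c z) :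
    ∃ π : Measure S, IsProbabilityMeasure π ∧ Q.Invariant π := by
  obtain ⟨x₀⟩ := ‹Nonempty S›
  let μ : ℕ → ProbabilityMeasure S := fun n => ⟨(Q ^ n) x₀, inferInstance⟩
  -- Weak compactness gives a limit along an ultrafilter without extracting a subsequence.
  let U : Ultrafilter ℕ := hyperfilter ℕ
  obtain ⟨π, -, hπ⟩ := isCompact_univ.ultrafilter_le_nhds (U.map μ) (by simp)
  have hlim : Tendsto μ U (𝓝 π) := hπ
  have hlim' := ProbabilityMeasure.tendsto_iff_forall_integral_tendsto.1 hlim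
  refine ⟨π, inferInstance, ?_⟩
  have hbind : IsProbabilityMeasure ((π : Measure S).bind Q) := inferInstance
  refine ext_of_forall_integral_eq_of_IsFiniteMeasure fun A => ?_
  have hA : Measurable A := A.continuous.measurable
  have hAb : ∀ x, |A x| ≤ ‖A‖ := fun x => A.norm_coe_le_norm x
  let QA : BoundedContinuousFunction S ℝ :=
    BoundedContinuousFunction.mkOfCompact ⟨fun x => ∫ y, A y ∂(Q x), hQ A A.continuous⟩
  rw [integral_bind_kernel _ _ hA hAb]
  have hQA : Tendsto (fun n => ∫ x, A x ∂((Q ^ (n + 1)) x₀)) U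
      (𝓝 (∫ x, ∫ y, A y ∂(Q x) ∂(π : Measure S))) := by
    refine (hlim' QA).congr fun n => ?_
    rw [pow_succ']
    exact (integral_bind_kernel _ _ hA hAb).symm
  -- Start the coupled chain from `Q x₀` and the point mass at `x₀`: after `n` steps its marginals
  -- are the laws at times `n + 1` and `n`, and its cost is at most `ρ ^ n * B`.
  have hdiff : Tendsto (fun n => ∫ x, A x ∂((Q ^ (n + 1)) x₀) - ∫ x, A x ∂((Q ^ n) x₀)) atTop
      (𝓝 0) := by
    rw [Metric.tendsto_atTop']
    intro e he
    obtain ⟨C, hC0, hC⟩ := exists_abs_sub_le_add_mul hc hc0 hcd A.continuous (half_pos he)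
    have hgeo : Tendsto (fun n : ℕ => C * (ρ ^ n * B)) atTop (𝓝 (C * (0 * B))) :=
      ((tendsto_pow_atTop_nhds_zero_of_lt_one hρ hρ').mul_const B).const_mul C
    rw [zero_mul, mul_zero] at hgeo
    obtain ⟨n₀, hn₀⟩ := eventually_atTop.1 (hgeo.eventually (eventually_lt_nhds (half_pos he)))
    refine ⟨n₀, fun n hn => ?_⟩
    rw [Real.dist_eq, sub_zero]
    have hΓ₀ := prod_mem_coupling (Q x₀) (Measure.dirac x₀)
    have hΓ := bind_mem_coupling (pow_map_of_intertwined measurable_fst h1 n)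
      (pow_map_of_intertwined measurable_snd h2 n) hΓ₀
    have e1 : (Q x₀).bind (Q ^ n) = (Q ^ (n + 1)) x₀ := by rw [pow_succ]; rfl
    have e2 : (Measure.dirac x₀).bind (Q ^ n) = (Q ^ n) x₀ :=
      Measure.dirac_bind (Kernel.measurable _) _
    rw [e1, e2] at hΓ
    refine (abs_integral_sub_integral_le_of_coupling hcm hB A hC hΓ).trans_lt ?_
    have hcost := integral_bind_le_of_contraction hcm hB
      (integral_pow_le_of_contraction hcm hB hρ h n) ((Q x₀).prod (Measure.dirac x₀))
    have hcB : ∫ z, c z ∂((Q x₀).prod (Measure.dirac x₀)) ≤ B :=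
      (le_abs_self _).trans (abs_integral_le_of_abs_le hB)
    have := hn₀ n hn.le
    have h3 := mul_le_mul_of_nonneg_left
      (hcost.trans (mul_le_mul_of_nonneg_left hcB (pow_nonneg hρ n))) hC0
    linarith
  have hU : (U : Filter ℕ) ≤ atTop := by
    rw [← Nat.cofinite_eq_atTop]; exact hyperfilter_le_cofinite
  have := tendsto_nhds_unique (hQA.sub (hlim' A)) (hdiff.mono_left hU)
  linarith

end Ergodicity

/-! ### Kernels given by random maps, and their synchronous coupling -/

section RandomMap

variable {S Ω : Type*} [MeasurableSpace S] [MeasurableSpace Ω]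

/-- The transition kernel applying a random map `F (·, ω)`, where `ω` has law `ρ`. -/
def randomMapKernel (ρ : Measure Ω) [IsProbabilityMeasure ρ] (F : S × Ω → S) : Kernel S S :=
  (Kernel.id ×ₖ Kernel.const S ρ).map F

variable {ρ : Measure Ω} [IsProbabilityMeasure ρ] {F : S × Ω → S}

theorem isMarkovKernel_randomMapKernel (hF : Measurable F) :
    IsMarkovKernel (randomMapKernel ρ F) := Kernel.IsMarkovKernel.map _ hF

theorem randomMapKernel_apply (hF : Measurable F) (x : S) :
    randomMapKernel ρ F x = ρ.map fun ω => F (x, ω) := by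
  rw [randomMapKernel, Kernel.map_apply _ hF, Kernel.prod_apply, Kernel.id_apply,
    Kernel.const_apply, Measure.dirac_prod, Measure.map_map hF measurable_prodMk_left]
  rfl

theorem integral_randomMapKernel (hF : Measurable F) (x : S) {A : S → ℝ} (hA : Measurable A) :
    ∫ y, A y ∂(randomMapKernel ρ F x) = ∫ ω, A (F (x, ω)) ∂ρ := by
  have h : Measurable fun ω => F (x, ω) := hF.comp measurable_prodMk_left
  rw [randomMapKernel_apply hF, integral_map h.aemeasurable hA.aestronglyMeasurable]

/-- The synchronous coupling of a random map with itself. -/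
def pairMap (F : S × Ω → S) (z : (S × S) × Ω) : S × S := (F (z.1.1, z.2), F (z.1.2, z.2))

theorem measurable_pairMap (hF : Measurable F) : Measurable (pairMap F) := by
  unfold pairMap
  exact (hF.comp (by fun_prop)).prodMk (hF.comp (by fun_prop))

theorem randomMapKernel_pairMap_map_fst (hF : Measurable F) (z : S × S) :
    (randomMapKernel ρ (pairMap F) z).map Prod.fst = randomMapKernel ρ F z.1 := by
  have h : Measurable fun ω => pairMap F (z, ω) :=
    (measurable_pairMap hF).comp measurable_prodMk_left
  rw [randomMapKernel_apply (measurable_pairMap hF), randomMapKernel_apply hF,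
    Measure.map_map measurable_fst h]
  rfl

theorem randomMapKernel_pairMap_map_snd (hF : Measurable F) (z : S × S) :
    (randomMapKernel ρ (pairMap F) z).map Prod.snd = randomMapKernel ρ F z.2 := by
  have h : Measurable fun ω => pairMap F (z, ω) :=
    (measurable_pairMap hF).comp measurable_prodMk_left
  rw [randomMapKernel_apply (measurable_pairMap hF), randomMapKernel_apply hF,
    Measure.map_map measurable_snd h]
  rfl

end RandomMap

/-! ### The exchange maps and the compact simplex -/

section Model

variable {ε : ℝ} {N : ℕ}

theorem continuous_exchange (i : Fin (N - 1)) :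
    Continuous fun z : simplex ε N × unitInterval => exchange i z.2 z.1 := by
  refine Continuous.subtype_mk ?_ _
  have h : ∀ k, Continuous fun z : simplex ε N × unitInterval => z.1.1 k := fun k =>
    (continuous_apply k).comp (continuous_subtype_val.comp continuous_fst)
  have h2 : Continuous fun z : simplex ε N × unitInterval => (z.2 : ℝ) := by fun_prop
  unfold exchangeVec
  exact (continuous_subtype_val.comp continuous_fst).add
    (((h2.mul (h _)).sub ((continuous_const.sub h2).mul (h _))).smul continuous_const)

/-- The exchange map as a function of the configuration and of the random parameters. -/
def exchangeMap (z : simplex ε N × (Fin (N - 1) × unitInterval)) : simplex ε N :=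
  exchange z.2.1 z.2.2 z.1

theorem measurable_exchangeMap : Measurable (exchangeMap (ε := ε) (N := N)) := by
  have h : Measurable fun w : Fin (N - 1) × (simplex ε N × unitInterval) =>
      exchange w.1 w.2.2 w.2.1 :=
    measurable_from_prod_countable_right fun i => (continuous_exchange i).measurable
  exact h.comp (g := fun w : Fin (N - 1) × (simplex ε N × unitInterval) =>
      exchange w.1 w.2.2 w.2.1)
    (f := fun z : simplex ε N × (Fin (N - 1) × unitInterval) => (z.2.1, (z.1, z.2.2)))
    (by fun_prop)

instance : CompactSpace (simplex ε N) := by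
  rw [← isCompact_iff_compactSpace]
  rcases Nat.eq_zero_or_pos N with rfl | hN
  · exact (Set.toFinite _).isCompact
  have hsub : simplex ε N ⊆ Set.pi Set.univ fun _ => Set.Icc 0 (N * ε) := by
    rintro x ⟨h0, h1⟩ k -
    refine ⟨h0 k, ?_⟩
    have hN' : (0 : ℝ) < N := by exact_mod_cast hN
    rw [← Finset.mul_sum] at h1
    rw [← h1, ← mul_assoc, mul_one_div_cancel hN'.ne', one_mul]
    exact Finset.single_le_sum (fun j _ => h0 j) (Finset.mem_univ k)
  refine (isCompact_univ_pi fun _ => isCompact_Icc).of_isClosed_subset ?_ hsub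
  have : simplex ε N = (⋂ k, {x | 0 ≤ x k}) ∩ {x | ∑ k, (1 / (N : ℝ)) * x k = ε} := by
    ext x; simp [simplex]
  rw [this]
  refine (isClosed_iInter fun k => isClosed_le continuous_const (continuous_apply k)).inter ?_
  exact isClosed_eq (by fun_prop) continuous_const

theorem nonempty_simplex (hN : 0 < N) (hε : 0 ≤ ε) : Nonempty (simplex ε N) := by
  refine ⟨⟨fun _ => ε, fun _ => hε, ?_⟩⟩
  have hN' : (N : ℝ) ≠ 0 := by exact_mod_cast hN.ne'
  rw [← Finset.mul_sum]
  simp [hN']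

/-! ### Partial-sum coordinates and the squared distance -/

/-- The sum of the first `j` coordinates. -/
def partialSum (x : Fin N → ℝ) (j : ℕ) : ℝ := ∑ k with k.1 < j, x k

theorem partialSum_zero (x : Fin N → ℝ) : partialSum x 0 = 0 := by simp [partialSum]

theorem partialSum_of_le (x : Fin N → ℝ) {j : ℕ} (hj : N ≤ j) : partialSum x j = ∑ k, x k := by
  unfold partialSum
  rw [Finset.filter_true_of_mem fun k _ => k.2.trans_le hj]

theorem partialSum_succ (x : Fin N → ℝ) (k : Fin N) :
    partialSum x (k + 1) = partialSum x k + x k := by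
  unfold partialSum
  have : (Finset.univ.filter fun l : Fin N => l.1 < k + 1) =
      insert k (Finset.univ.filter fun l : Fin N => l.1 < k) := by
    ext l
    simp only [Finset.mem_filter, Finset.mem_univ, true_and, Finset.mem_insert, Fin.ext_iff]
    omega
  rw [this, Finset.sum_insert (by simp), add_comm]

theorem partialSum_sub (x y : Fin N → ℝ) (j : ℕ) :
    partialSum (x - y) j = partialSum x j - partialSum y j := by
  simp [partialSum, Finset.sum_sub_distrib]

theorem continuous_partialSum (j : ℕ) : Continuous fun x : Fin N → ℝ => partialSum x j := by
  unfold partialSum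
  fun_prop

/-- Energy moves only across bond `i`, so only the partial sum that separates its two sites can
change. This is what makes the metric adapted to the dynamics. -/
theorem partialSum_exchangeVec (i : Fin (N - 1)) (α : ℝ) (x : Fin N → ℝ) (j : ℕ) :
    partialSum (exchangeVec i α x) j =
      if j = i + 1 then (1 - α) * partialSum x i + α * partialSum x (i + 2)
      else partialSum x j := by
  have hl : partialSum x (i + 1) = partialSum x i + x (left i) := partialSum_succ x (left i)
  have hr : partialSum x (i + 2) = partialSum x (i + 1) + x (right i) :=
    partialSum_succ x (right i)
  have hs : ∀ k : Fin N, partialSum (Pi.single k (1 : ℝ)) j = if k.1 < j then 1 else 0 := by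
    intro k
    simp [partialSum]
  have he : partialSum (exchangeVec i α x) j = partialSum x j +
      (α * x (right i) - (1 - α) * x (left i)) *
        (partialSum (Pi.single (left i) (1 : ℝ)) j - partialSum (Pi.single (right i) (1 : ℝ)) j) := by
    simp only [partialSum, exchangeVec, Pi.add_apply, Pi.smul_apply, Pi.sub_apply, smul_eq_mul,
      Finset.sum_add_distrib, ← Finset.mul_sum, Finset.sum_sub_distrib]
  rw [he, hs, hs]
  have hle : (left i).1 = i := rfl
  have hri : (right i).1 = i + 1 := rfl
  rw [hle, hri]
  rcases lt_trichotomy j (i.1 + 1) with h | h | h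
  · rw [if_neg (by omega), if_neg (by omega), if_neg (by omega)]; ring
  · rw [if_pos (by omega), if_neg (by omega), if_pos h, h, hr, hl]
    ring
  · rw [if_pos (by omega), if_pos (by omega), if_neg (by omega)]; ring

/-- By linearity the difference of two synchronously coupled copies evolves by the same map. -/
theorem exchangeVec_sub (i : Fin (N - 1)) (α : ℝ) (x y : Fin N → ℝ) :
    exchangeVec i α (x - y) = exchangeVec i α x - exchangeVec i α y := by
  ext k
  simp only [exchangeVec, Pi.add_apply, Pi.sub_apply, Pi.smul_apply, smul_eq_mul]
  ring

theorem adaptedDist_sq (x y : simplex ε N) :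
    adaptedDist x y ^ 2 = ∑ j ∈ Finset.range (N - 1), partialSum (x.1 - y.1) (j + 1) ^ 2 := by
  rw [adaptedDist, Real.sq_sqrt (Finset.sum_nonneg fun _ _ => sq_nonneg _), Finset.sum_range]
  refine Finset.sum_congr rfl fun i _ => ?_
  have : Finset.Iic (left i) = Finset.univ.filter fun k : Fin N => k.1 < i + 1 := by
    ext k
    simp only [Finset.mem_Iic, Finset.mem_filter, Finset.mem_univ, true_and, left, Fin.le_def]
    omega
  rw [this]
  rfl

/-- The squared adapted distance. -/
def cost (z : simplex ε N × simplex ε N) : ℝ := adaptedDist z.1 z.2 ^ 2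

theorem cost_eq (z : simplex ε N × simplex ε N) :
    cost z = ∑ j ∈ Finset.range (N - 1), partialSum (z.1.1 - z.2.1) (j + 1) ^ 2 :=
  adaptedDist_sq _ _

theorem cost_nonneg (z : simplex ε N × simplex ε N) : 0 ≤ cost z := sq_nonneg _

theorem continuous_cost : Continuous (cost (ε := ε) (N := N)) := by
  have : (cost (ε := ε) (N := N)) = fun z =>
      ∑ j ∈ Finset.range (N - 1), partialSum (z.1.1 - z.2.1) (j + 1) ^ 2 := funext cost_eq
  rw [this]
  refine continuous_finsetSum _ fun j _ => Continuous.pow ?_ 2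
  exact (continuous_partialSum _).comp (by fun_prop)

theorem measurable_cost : Measurable (cost (ε := ε) (N := N)) :=
  continuous_cost.measurable

theorem sum_eq_of_mem_simplex (hN : 0 < N) {x : Fin N → ℝ} (hx : x ∈ simplex ε N) :
    ∑ k, x k = ε * N := by
  have hN' : (N : ℝ) ≠ 0 := by exact_mod_cast hN.ne'
  have := hx.2
  rw [← Finset.mul_sum] at this
  field_simp at this
  linarith

theorem partialSum_sub_eq_zero (hN : 0 < N) (x y : simplex ε N) {j : ℕ} (hj : N ≤ j) :
    partialSum (x.1 - y.1) j = 0 := by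
  rw [partialSum_sub, partialSum_of_le _ hj, partialSum_of_le _ hj,
    sum_eq_of_mem_simplex hN x.2, sum_eq_of_mem_simplex hN y.2, sub_self]

theorem eq_of_cost_eq_zero (hN : 0 < N) (z : simplex ε N × simplex ε N) (hz : cost z = 0) :
    z.1 = z.2 := by
  have h : ∀ j, partialSum (z.1.1 - z.2.1) j = 0 := by
    intro j
    rcases Nat.eq_zero_or_pos j with rfl | hj
    · exact partialSum_zero _
    rcases Nat.lt_or_ge j N with hjN | hjN
    · rw [cost_eq, Finset.sum_eq_zero_iff_of_nonneg fun _ _ => sq_nonneg _] at hz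
      have := hz (j - 1) (Finset.mem_range.2 (by omega))
      rw [Nat.sub_add_cancel hj] at this
      exact pow_eq_zero_iff two_ne_zero |>.1 this
    · exact partialSum_sub_eq_zero hN z.1 z.2 hjN
  apply Subtype.ext
  ext k
  have := partialSum_succ (z.1.1 - z.2.1) k
  rw [h, h, zero_add] at this
  exact sub_eq_zero.1 this.symm

theorem partialSum_mem_Icc (hN : 0 < N) (x : simplex ε N) (j : ℕ) :
    partialSum x.1 j ∈ Set.Icc 0 (ε * N) := by
  refine ⟨Finset.sum_nonneg fun k _ => x.2.1 k, ?_⟩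
  rw [← sum_eq_of_mem_simplex hN x.2]
  exact Finset.sum_le_sum_of_subset_of_nonneg (Finset.filter_subset _ _) fun k _ _ => x.2.1 k

theorem cost_le (hN : 0 < N) (z : simplex ε N × simplex ε N) :
    cost z ≤ (ε * N) ^ 2 * (N - 1) := by
  rw [cost_eq]
  have h : ∀ j ∈ Finset.range (N - 1), partialSum (z.1.1 - z.2.1) (j + 1) ^ 2 ≤ (ε * N) ^ 2 := by
    intro j _
    have h1 := partialSum_mem_Icc hN z.1 (j + 1)
    have h2 := partialSum_mem_Icc hN z.2 (j + 1)
    rw [partialSum_sub]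
    apply sq_le_sq'
    · linarith [h1.1, h2.2]
    · linarith [h1.2, h2.1]
  refine (Finset.sum_le_sum h).trans (le_of_eq ?_)
  rw [Finset.sum_const, Finset.card_range, nsmul_eq_mul, Nat.cast_sub hN, Nat.cast_one]
  ring

theorem abs_cost_le (hN : 0 < N) (z : simplex ε N × simplex ε N) :
    |cost z| ≤ (ε * N) ^ 2 * (N - 1) := by
  rw [abs_of_nonneg (cost_nonneg z)]
  exact cost_le hN z

theorem cost_exchange (i : Fin (N - 1)) (α : unitInterval) (x y : simplex ε N) :
    cost (exchange i α x, exchange i α y) = cost (x, y) +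
      (((1 - α) * partialSum (x.1 - y.1) i + α * partialSum (x.1 - y.1) (i + 2)) ^ 2 -
        partialSum (x.1 - y.1) (i + 1) ^ 2) := by
  rw [cost_eq, cost_eq]
  simp only [exchange]
  rw [← exchangeVec_sub]
  have hi : i.1 ∈ Finset.range (N - 1) := Finset.mem_range.2 i.2
  rw [← Finset.add_sum_erase _ _ hi, ← Finset.add_sum_erase _ _ hi]
  have : ∑ j ∈ (Finset.range (N - 1)).erase i.1,
      partialSum (exchangeVec i α (x.1 - y.1)) (j + 1) ^ 2 =
      ∑ j ∈ (Finset.range (N - 1)).erase i.1, partialSum (x.1 - y.1) (j + 1) ^ 2 := by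
    refine Finset.sum_congr rfl fun j hj => ?_
    have := Finset.ne_of_mem_erase hj
    rw [partialSum_exchangeVec, if_neg (by omega)]
  rw [this, partialSum_exchangeVec, if_pos rfl]
  ring

/-! ### The embedded jump chain and its contraction -/

/-- The law of a uniformly chosen bond together with an independent splitting ratio. -/
def bondLaw (N : ℕ) (P : Measure unitInterval) : Measure (Fin (N - 1) × unitInterval) :=
  ((N - 1 : ℕ) : ENNReal)⁻¹ • (Measure.count.prod P)

theorem isProbabilityMeasure_bondLaw (hN : 2 ≤ N) (P : Measure unitInterval)
    [IsProbabilityMeasure P] : IsProbabilityMeasure (bondLaw N P) := by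
  constructor
  have h0 : ((N - 1 : ℕ) : ENNReal) ≠ 0 := by simp only [ne_eq, Nat.cast_eq_zero]; omega
  rw [bondLaw, Measure.smul_apply, ← Set.univ_prod_univ, Measure.prod_prod,
    measure_univ (μ := P), Measure.count_univ]
  simp only [mul_one, smul_eq_mul, ENat.card_eq_coe_fintype_card, Fintype.card_fin]
  exact ENNReal.inv_mul_cancel h0 (ENNReal.natCast_ne_top _)

theorem integral_bondLaw (P : Measure unitInterval) [IsProbabilityMeasure P]
    {g : Fin (N - 1) × unitInterval → ℝ} (hg : Measurable g) {C : ℝ} (hC : ∀ z, |g z| ≤ C) :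
    ∫ z, g z ∂(bondLaw N P) = ((N - 1 : ℕ) : ℝ)⁻¹ * ∑ i, ∫ α, g (i, α) ∂P := by
  rw [bondLaw, integral_smul_measure, integral_prod _ (integrable_of_abs_le hg hC),
    integral_count, ENNReal.toReal_inv, ENNReal.toReal_natCast, smul_eq_mul]

/-- The second moment is the squared mean `((a + b) / 2) ^ 2` plus the variance `σ² (b - a) ^ 2`,
rewritten by the parallelogram law. -/
theorem integral_sq_mix (P : Measure unitInterval) [IsProbabilityMeasure P]
    (hmean : ∫ α, (α : ℝ) ∂P = 1 / 2) (a b : ℝ) :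
    ∫ α : unitInterval, ((1 - α) * a + α * b) ^ 2 ∂P = 1 / 2 * (a ^ 2 + b ^ 2) -
      (1 / 4 - variance (fun α : unitInterval => (α : ℝ)) P) * (b - a) ^ 2 := by
  have hm : Measurable fun α : unitInterval => (α : ℝ) := measurable_subtype_coe
  have hb : ∀ α : unitInterval, |(α : ℝ)| ≤ 1 := fun α => by
    rw [abs_of_nonneg α.2.1]; exact α.2.2
  have i1 : Integrable (fun α : unitInterval => (α : ℝ)) P := integrable_of_abs_le hm hb
  have i2 : Integrable (fun α : unitInterval => (α : ℝ) ^ 2) P :=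
    integrable_of_abs_le (C := 1) (hm.pow_const 2) fun α => by
      rw [abs_pow]; exact pow_le_one₀ (abs_nonneg _) (hb α)
  have hv : variance (fun α : unitInterval => (α : ℝ)) P = ∫ α, (α : ℝ) ^ 2 ∂P - 1 / 4 := by
    rw [variance_eq_sub (MemLp.of_bound hm.aestronglyMeasurable 1 (ae_of_all _ hb)), hmean]
    norm_num
  have e : ∀ α : unitInterval, ((1 - (α : ℝ)) * a + α * b) ^ 2 =
      (b - a) ^ 2 * (α : ℝ) ^ 2 + 2 * a * (b - a) * (α : ℝ) + a ^ 2 := fun α => by ring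
  simp_rw [e]
  have i3 : Integrable (fun α : unitInterval =>
      (b - a) ^ 2 * (α : ℝ) ^ 2 + 2 * a * (b - a) * (α : ℝ)) P :=
    (i2.const_mul _).add (i1.const_mul _)
  rw [integral_add i3 (integrable_const _),
    integral_add (i2.const_mul _) (i1.const_mul _), integral_const_mul, integral_const_mul, hmean,
    hv]
  simp
  ring

variable (P : Measure unitInterval) [IsProbabilityMeasure (bondLaw N P)]

/-- One step of the embedded jump chain. -/
def jumpKernel (ε : ℝ) (N : ℕ) (P : Measure unitInterval) [IsProbabilityMeasure (bondLaw N P)] :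
    Kernel (simplex ε N) (simplex ε N) := randomMapKernel (bondLaw N P) exchangeMap

/-- The synchronous coupling of two copies of the embedded jump chain. -/
def pairJumpKernel (ε : ℝ) (N : ℕ) (P : Measure unitInterval)
    [IsProbabilityMeasure (bondLaw N P)] :
    Kernel (simplex ε N × simplex ε N) (simplex ε N × simplex ε N) :=
  randomMapKernel (bondLaw N P) (pairMap exchangeMap)


instance : IsMarkovKernel (jumpKernel ε N P) :=
  isMarkovKernel_randomMapKernel measurable_exchangeMap

instance : IsMarkovKernel (pairJumpKernel ε N P) :=
  isMarkovKernel_randomMapKernel (measurable_pairMap measurable_exchangeMap)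

theorem pairJumpKernel_map_fst (z : simplex ε N × simplex ε N) :
    (pairJumpKernel ε N P z).map Prod.fst = jumpKernel ε N P z.1 :=
  randomMapKernel_pairMap_map_fst measurable_exchangeMap z

theorem pairJumpKernel_map_snd (z : simplex ε N × simplex ε N) :
    (pairJumpKernel ε N P z).map Prod.snd = jumpKernel ε N P z.2 :=
  randomMapKernel_pairMap_map_snd measurable_exchangeMap z

variable [IsProbabilityMeasure P]

theorem integral_jumpKernel (x : simplex ε N) {A : simplex ε N → ℝ} (hA : Measurable A) {C : ℝ}
    (hC : ∀ x, |A x| ≤ C) : ∫ y, A y ∂(jumpKernel ε N P x) =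
      ((N - 1 : ℕ) : ℝ)⁻¹ * ∑ i, ∫ α, A (exchange i α x) ∂P := by
  rw [jumpKernel, integral_randomMapKernel measurable_exchangeMap x hA]
  exact integral_bondLaw P (g := fun ω => A (exchangeMap (x, ω)))
    (hA.comp (measurable_exchangeMap.comp measurable_prodMk_left)) fun _ => hC _

/-- Uniformization: the process jumps at total rate `Λ (N - 1)` according to the jump kernel, so the
generator is a bounded operator. -/
theorem generator_eq (hN : 2 ≤ N) (Λ : ℝ) {A : simplex ε N → ℝ} (hA : Measurable A) {C : ℝ}
    (hC : ∀ x, |A x| ≤ C) (x : simplex ε N) :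
    generator Λ P A x = Λ * (N - 1 : ℕ) * (∫ y, A y ∂(jumpKernel ε N P x) - A x) := by
  have h0 : ((N - 1 : ℕ) : ℝ) ≠ 0 := by simp only [ne_eq, Nat.cast_eq_zero]; omega
  rw [integral_jumpKernel P x hA hC, generator]
  have : ∀ i : Fin (N - 1), ∫ α, (A (exchange i α x) - A x) ∂P =
      ∫ α, A (exchange i α x) ∂P - A x := by
    intro i
    rw [integral_sub _ (integrable_const _)]
    · simp
    · exact integrable_of_abs_le (hA.comp (measurable_exchangeMap.comp
        (measurable_prodMk_left.comp measurable_prodMk_left))) fun _ => hC _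
  simp_rw [this]
  rw [Finset.sum_sub_distrib, Finset.sum_const, Finset.card_univ, Fintype.card_fin, nsmul_eq_mul]
  field_simp

theorem continuous_integral_jumpKernel {A : simplex ε N → ℝ} (hA : Continuous A) :
    Continuous fun x => ∫ y, A y ∂(jumpKernel ε N P x) := by
  obtain ⟨C, hC⟩ := isCompact_univ.exists_bound_of_continuousOn hA.continuousOn
  have hC' : ∀ x, |A x| ≤ C := fun x => hC x (Set.mem_univ x)
  simp_rw [integral_jumpKernel P _ hA.measurable hC']
  refine continuous_const.mul (continuous_finsetSum _ fun i _ => ?_)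
  refine continuous_of_dominated (bound := fun _ => C) (fun x => ?_)
    (fun x => ae_of_all _ fun α => hC' _) (integrable_const _) (ae_of_all _ fun α => ?_)
  · exact (hA.comp ((continuous_exchange i).comp (by fun_prop :
      Continuous fun α : unitInterval => (x, α)))).measurable.aestronglyMeasurable
  · exact hA.comp ((continuous_exchange i).comp (by fun_prop :
      Continuous fun x : simplex ε N => (x, α)))

/-- The synchronous coupling contracts the squared adapted distance in one step. -/
theorem integral_cost_pairJumpKernel_le (hN : 2 ≤ N) (hmean : ∫ α, (α : ℝ) ∂P = 1 / 2)
    (hvar : variance (fun α : unitInterval => (α : ℝ)) P < 1 / 4)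
    (z : simplex ε N × simplex ε N) :
    ∫ w, cost w ∂(pairJumpKernel ε N P z) ≤
      (1 - (1 - 4 * variance (fun α : unitInterval => (α : ℝ)) P) *
        Real.sin (Real.pi / (N + 2)) ^ 2 / (N - 1 : ℕ)) * cost z := by
  set v := variance (fun α : unitInterval => (α : ℝ)) P
  obtain ⟨x, y⟩ := z
  have hv0 : 0 ≤ v := variance_nonneg _ _
  have hM : (0 : ℝ) < (N - 1 : ℕ) := by
    have : 0 < N - 1 := by omega
    exact_mod_cast this
  have hF := measurable_pairMap (measurable_exchangeMap (ε := ε) (N := N))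
  rw [pairJumpKernel, integral_randomMapKernel hF _ measurable_cost]
  rw [integral_bondLaw P (g := fun ω => cost (pairMap exchangeMap ((x, y), ω)))
    (measurable_cost.comp (hF.comp measurable_prodMk_left))
    fun ω => abs_cost_le (by omega) _]
  set D : ℕ → ℝ := partialSum (x.1 - y.1) with hD
  have hint : ∀ i : Fin (N - 1),
      ∫ α, cost (pairMap exchangeMap ((x, y), (i, α))) ∂P = cost (x, y) +
        (1 / 2 * (D i ^ 2 + D (i + 2) ^ 2) - (1 / 4 - v) * (D (i + 2) - D i) ^ 2
          - D (i + 1) ^ 2) := by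
    intro i
    have e : ∀ α : unitInterval, cost (pairMap exchangeMap ((x, y), (i, α))) =
        ((1 - α) * D i + α * D (i + 2)) ^ 2 + (cost (x, y) - D (i + 1) ^ 2) := by
      intro α
      refine (cost_exchange i α x y).trans ?_
      ring
    simp_rw [e]
    rw [integral_add _ (integrable_const _), integral_sq_mix P hmean]
    · simp only [integral_const, probReal_univ, smul_eq_mul, one_mul]
      ring
    · have hcont : Continuous fun α : unitInterval =>
          ((1 - (α : ℝ)) * D i + α * D (i + 2)) ^ 2 := by fun_prop
      exact hcont.integrable_of_hasCompactSupport (HasCompactSupport.of_compactSpace _)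
  simp_rw [hint]
  rw [Finset.sum_add_distrib, Finset.sum_const, Finset.card_univ, Fintype.card_fin, nsmul_eq_mul,
    ← Finset.sum_range fun j => (1 / 2 * (D j ^ 2 + D (j + 2) ^ 2) -
      (1 / 4 - v) * (D (j + 2) - D j) ^ 2 - D (j + 1) ^ 2)]
  -- With `M = N - 1` the angle `π / (M + 3)` is `π / (N + 2)`, and `4 c = 1 - 4 v`.
  have hkey := sum_update_le (M := N - 1) (D := D) (c := 1 / 4 - v) (partialSum_zero _)
    (partialSum_sub_eq_zero (by omega) x y (by omega)) (by linarith) (by linarith)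
  have hcost : cost (x, y) = ∑ j ∈ Finset.range (N - 1), D (j + 1) ^ 2 := cost_eq _
  rw [← hcost] at hkey
  have hang : (((N - 1 : ℕ) : ℝ) + 3) = N + 2 := by
    rw [Nat.cast_sub (by omega)]; push_cast; ring
  rw [hang] at hkey
  rw [mul_add, inv_mul_cancel_left₀ hM.ne']
  have h2 := mul_le_mul_of_nonneg_left hkey (inv_nonneg.2 hM.le)
  refine (add_le_add_right h2 _).trans (le_of_eq ?_)
  field_simp
  ring

end Model

/-! ### Existence and uniqueness of the transition semigroup -/

section Semigroup

variable {ε : ℝ} {N : ℕ} {P : Measure unitInterval} [IsProbabilityMeasure P]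
  [IsProbabilityMeasure (bondLaw N P)] {Λ : ℝ}
  {κ κ' : ℝ≥0 → Kernel (simplex ε N) (simplex ε N)}

theorem measurable_generator (hN : 2 ≤ N) {A : simplex ε N → ℝ} (hA : Measurable A) {C : ℝ}
    (hC : ∀ x, |A x| ≤ C) : Measurable (generator Λ P A) := by
  rw [funext (generator_eq P hN Λ hA hC)]
  exact ((measurable_integral_kernel _ hA).sub hA).const_mul _

theorem abs_generator_le (hN : 2 ≤ N) (hΛ : 0 ≤ Λ) {A : simplex ε N → ℝ} (hA : Measurable A)
    {C : ℝ} (hC : ∀ x, |A x| ≤ C) (x : simplex ε N) :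
    |generator Λ P A x| ≤ Λ * (N - 1 : ℕ) * 2 * C := by
  have hK : 0 ≤ Λ * (N - 1 : ℕ) := by positivity
  rw [generator_eq P hN Λ hA hC, abs_mul, abs_of_nonneg hK, mul_assoc _ (2 : ℝ)]
  refine mul_le_mul_of_nonneg_left ?_ hK
  have h1 : |∫ y, A y ∂(jumpKernel ε N P x)| ≤ C := abs_integral_le_of_abs_le hC
  refine (abs_sub _ _).trans ?_
  linarith [hC x]

/-- Second order control of the increments of the semigroup, uniform in the base time. -/
theorem IsTransitionSemigroup.exists_abs_increment_sub_le (h : IsTransitionSemigroup Λ P κ)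
    (hN : 2 ≤ N) (hΛ : 0 ≤ Λ) {A : simplex ε N → ℝ} (hA : Measurable A) {C : ℝ}
    (hC : ∀ x, |A x| ≤ C) (x : simplex ε N) {e : ℝ} (he : 0 < e) :
    ∃ δ : ℝ≥0, 0 < δ ∧ ∀ s < δ, ∀ t : ℝ≥0,
      |∫ y, A y ∂(κ (t + s) x) - ∫ y, A y ∂(κ t x) - s * ∫ y, generator Λ P A y ∂(κ t x)| ≤
        e * s := by
  have := h.markov
  have hev := Metric.tendstoUniformly_iff.1 (h.hasGenerator A hA ⟨C, hC⟩) e he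
  obtain ⟨δ, hδ, hδs⟩ := (mem_nhdsGT_iff_exists_Ioo_subset).1 hev
  refine ⟨δ, hδ, fun s hs t => ?_⟩
  rcases eq_or_ne s 0 with rfl | hs0
  · simp
  have hs' := hδs ⟨pos_iff_ne_zero.2 hs0, hs⟩
  have hspos : (0 : ℝ) < s := by exact_mod_cast pos_iff_ne_zero.2 hs0
  have hpt : ∀ y, |∫ w, A w ∂(κ s y) - A y - s * generator Λ P A y| ≤ e * s := by
    intro y
    have hy : dist (generator Λ P A y) ((∫ w, A w ∂(κ s y) - A y) / (s : ℝ)) < e := hs' y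
    rw [dist_comm, Real.dist_eq] at hy
    have e1 : ∫ w, A w ∂(κ s y) - A y - s * generator Λ P A y =
        ((∫ w, A w ∂(κ s y) - A y) / (s : ℝ) - generator Λ P A y) * s := by
      field_simp
    rw [e1, abs_mul, abs_of_pos hspos]
    exact mul_le_mul_of_nonneg_right hy.le hspos.le
  -- The error at base time `t` is the `κ t x`-average of the error at time `0`, so `δ` need not
  -- depend on `t`.
  have hadd : ∫ y, A y ∂(κ (t + s) x) = ∫ y, ∫ w, A w ∂(κ s y) ∂(κ t x) := by
    rw [add_comm t s, h.add]
    exact integral_bind_kernel _ _ hA hC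
  have i1 : Integrable (fun y => ∫ w, A w ∂(κ s y)) (κ t x) :=
    integrable_of_abs_le (measurable_integral_kernel _ hA) fun _ => abs_integral_le_of_abs_le hC
  have i2 : Integrable A (κ t x) := integrable_of_abs_le hA hC
  have i3 : Integrable (generator Λ P A) (κ t x) :=
    integrable_of_abs_le (measurable_generator hN hA hC) (abs_generator_le hN hΛ hA hC)
  have i4 : Integrable (fun y => ∫ w, A w ∂(κ s y) - A y) (κ t x) := i1.sub i2
  rw [hadd, ← integral_sub i1 i2, ← integral_const_mul, ← integral_sub i4 (i3.const_mul _)]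
  exact abs_integral_le_of_abs_le hpt

/-- The forward equation. A right derivative, together with continuity, is enough for the mean value
inequality used for uniqueness. -/
theorem IsTransitionSemigroup.hasDerivWithinAt (h : IsTransitionSemigroup Λ P κ)
    (hN : 2 ≤ N) (hΛ : 0 ≤ Λ) {A : simplex ε N → ℝ} (hA : Measurable A) {C : ℝ}
    (hC : ∀ x, |A x| ≤ C) (x : simplex ε N) {t : ℝ} (ht : 0 ≤ t) :
    HasDerivWithinAt (fun t : ℝ => ∫ y, A y ∂(κ t.toNNReal x))
      (∫ y, generator Λ P A y ∂(κ t.toNNReal x)) (Set.Ici t) t := by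
  rw [hasDerivWithinAt_iff_isLittleO, Asymptotics.isLittleO_iff]
  intro e he
  obtain ⟨δ, hδ, hδs⟩ := h.exists_abs_increment_sub_le hN hΛ hA hC x he
  have hδ' : (0 : ℝ) < δ := by exact_mod_cast hδ
  have : Set.Iio (t + δ) ∈ 𝓝[≥] t := mem_nhdsWithin_of_mem_nhds (Iio_mem_nhds (by linarith))
  filter_upwards [this, self_mem_nhdsWithin] with u hu hu'
  have hut : 0 ≤ u - t := sub_nonneg.2 hu'
  have hs : (u - t).toNNReal < δ := by
    rw [Real.toNNReal_lt_iff_lt_coe hut]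
    linarith [show u < t + δ from hu]
  have key := hδs _ hs t.toNNReal
  rw [← Real.toNNReal_add ht hut, add_sub_cancel, Real.coe_toNNReal _ hut] at key
  rw [smul_eq_mul, Real.norm_eq_abs, Real.norm_of_nonneg hut]
  exact key

/-- Since `δ` is uniform in the base time, forward increments also control the left side: the
function is locally Lipschitz with constant `1 + K`. -/
theorem IsTransitionSemigroup.continuousOn (h : IsTransitionSemigroup Λ P κ)
    (hN : 2 ≤ N) (hΛ : 0 ≤ Λ) {A : simplex ε N → ℝ} (hA : Measurable A) {C : ℝ}
    (hC : ∀ x, |A x| ≤ C) (x : simplex ε N) :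
    ContinuousOn (fun t : ℝ => ∫ y, A y ∂(κ t.toNNReal x)) (Set.Ici 0) := by
  have := h.markov
  obtain ⟨δ, hδ, hδs⟩ := h.exists_abs_increment_sub_le hN hΛ hA hC x one_pos
  set K : ℝ := Λ * (N - 1 : ℕ) * 2 * C
  have hC0 : 0 ≤ C := (abs_nonneg _).trans (hC x)
  have hK : 0 ≤ K := by positivity
  have hinc : ∀ t u : ℝ, 0 ≤ t → t ≤ u → u - t < δ →
      |∫ y, A y ∂(κ u.toNNReal x) - ∫ y, A y ∂(κ t.toNNReal x)| ≤ (1 + K) * (u - t) := by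
    intro t u ht htu hlt
    have hut : 0 ≤ u - t := sub_nonneg.2 htu
    have hs : (u - t).toNNReal < δ := (Real.toNNReal_lt_iff_lt_coe hut).2 hlt
    have key := hδs _ hs t.toNNReal
    rw [← Real.toNNReal_add ht hut, add_sub_cancel, Real.coe_toNNReal _ hut] at key
    have hgen : |∫ y, generator Λ P A y ∂(κ t.toNNReal x)| ≤ K :=
      abs_integral_le_of_abs_le (abs_generator_le hN hΛ hA hC)
    have h1 : |(u - t) * ∫ y, generator Λ P A y ∂(κ t.toNNReal x)| ≤ (u - t) * K := by
      rw [abs_mul, abs_of_nonneg hut]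
      exact mul_le_mul_of_nonneg_left hgen hut
    have h2 := abs_add_le (∫ y, A y ∂(κ u.toNNReal x) - ∫ y, A y ∂(κ t.toNNReal x) -
      (u - t) * ∫ y, generator Λ P A y ∂(κ t.toNNReal x))
      ((u - t) * ∫ y, generator Λ P A y ∂(κ t.toNNReal x))
    rw [sub_add_cancel] at h2
    linarith
  rw [Metric.continuousOn_iff]
  intro t ht e he
  refine ⟨min δ (e / (1 + K)), lt_min (by exact_mod_cast hδ) (by positivity), fun u hu hut => ?_⟩
  rw [Real.dist_eq] at hut ⊢
  have hb : |∫ y, A y ∂(κ u.toNNReal x) - ∫ y, A y ∂(κ t.toNNReal x)| ≤ (1 + K) * |u - t| := by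
    rcases le_total t u with htu | htu
    · rw [abs_of_nonneg (sub_nonneg.2 htu)] at hut ⊢
      exact hinc t u ht htu (hut.trans_le (min_le_left _ _))
    · rw [abs_sub_comm u t, abs_of_nonneg (sub_nonneg.2 htu)] at hut ⊢
      rw [abs_sub_comm]
      exact hinc u t hu htu (hut.trans_le (min_le_left _ _))
  refine hb.trans_lt ?_
  calc (1 + K) * |u - t| < (1 + K) * (e / (1 + K)) :=
        mul_lt_mul_of_pos_left (hut.trans_le (min_le_right _ _)) (by positivity)
    _ = e := by field_simp

/-- Picard iteration: the difference starts at zero, and its derivative is the same difference for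
`generator Λ P A`, whose bound is `2 Λ (N - 1) C`. Integrating the estimate of order `m` for that
function gives order `m + 1` for `A`. -/
theorem IsTransitionSemigroup.abs_integral_sub_le (h : IsTransitionSemigroup Λ P κ)
    (h' : IsTransitionSemigroup Λ P κ') (hN : 2 ≤ N) (hΛ : 0 ≤ Λ) (x : simplex ε N) (m : ℕ)
    {A : simplex ε N → ℝ} (hA : Measurable A) {C : ℝ} (hC : ∀ x, |A x| ≤ C) {t : ℝ}
    (ht : 0 ≤ t) :
    |∫ y, A y ∂(κ t.toNNReal x) - ∫ y, A y ∂(κ' t.toNNReal x)| ≤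
      2 * C * ((Λ * (N - 1 : ℕ) * 2 * t) ^ m / m.factorial) := by
  have := h.markov
  have := h'.markov
  induction m generalizing A C t with
  | zero =>
    have h1 : |∫ y, A y ∂(κ t.toNNReal x)| ≤ C := abs_integral_le_of_abs_le hC
    have h2 : |∫ y, A y ∂(κ' t.toNNReal x)| ≤ C := abs_integral_le_of_abs_le hC
    simp only [pow_zero, Nat.factorial_zero, Nat.cast_one, div_one, mul_one]
    refine (abs_sub _ _).trans ?_
    linarith
  | succ m ih =>
    set K : ℝ := Λ * (N - 1 : ℕ) * 2 with hK
    have hIci : Set.Icc 0 t ⊆ Set.Ici 0 := Set.Icc_subset_Ici_self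
    have hB : ∀ s, HasDerivAt (fun s : ℝ => 2 * C * ((K * s) ^ (m + 1) / (m + 1).factorial))
        (2 * (K * C) * ((K * s) ^ m / m.factorial)) s := by
      intro s
      have h1 : HasDerivAt (fun s : ℝ => K * s) K s := by
        simpa using (hasDerivAt_id s).const_mul K
      have h2 := ((h1.pow (m + 1)).div_const ((m + 1).factorial : ℝ)).const_mul (2 * C)
      convert! h2 using 1
      rw [Nat.factorial_succ]
      push_cast
      have : (m.factorial : ℝ) ≠ 0 := by positivity
      field_simp
    refine image_norm_le_of_norm_deriv_right_le_deriv_boundary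
      (f := fun t : ℝ => ∫ y, A y ∂(κ t.toNNReal x) - ∫ y, A y ∂(κ' t.toNNReal x))
      (((h.continuousOn hN hΛ hA hC x).sub (h'.continuousOn hN hΛ hA hC x)).mono hIci)
      (fun s hs => (h.hasDerivWithinAt hN hΛ hA hC x hs.1).sub
        (h'.hasDerivWithinAt hN hΛ hA hC x hs.1)) ?_ hB (fun s hs => ?_)
      (Set.right_mem_Icc.2 ht)
    · simp [h.zero, h'.zero]
    · exact ih (measurable_generator hN hA hC) (abs_generator_le hN hΛ hA hC) hs.1

/-- A transition semigroup is determined by its generator. -/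
theorem IsTransitionSemigroup.unique (h : IsTransitionSemigroup Λ P κ)
    (h' : IsTransitionSemigroup Λ P κ') (hN : 2 ≤ N) (hΛ : 0 ≤ Λ) : κ = κ' := by
  have := h.markov
  have := h'.markov
  ext t x s hs
  -- Indicators are admissible test functions because the generator acts on all bounded Borel
  -- functions.
  let A : simplex ε N → ℝ := s.indicator fun _ => 1
  have hA : Measurable A := measurable_const.indicator hs
  have hC : ∀ y, |A y| ≤ 1 := fun y => by
    by_cases hy : y ∈ s <;> simp [A, hy]
  have hlim : Tendsto (fun m : ℕ => 2 * 1 *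
      ((Λ * (N - 1 : ℕ) * 2 * (t : ℝ)) ^ m / m.factorial)) atTop (𝓝 (2 * 1 * 0)) :=
    (FloorSemiring.tendsto_pow_div_factorial_atTop _).const_mul _
  rw [mul_zero] at hlim
  have hle := ge_of_tendsto' hlim fun m => h.abs_integral_sub_le h' hN hΛ x m hA hC t.2
  have heq := sub_eq_zero.1 (abs_eq_zero.1 (le_antisymm hle (abs_nonneg _)))
  rw [Real.toNNReal_coe, integral_indicator_const _ hs, integral_indicator_const _ hs, smul_eq_mul,
    smul_eq_mul, mul_one, mul_one] at heq
  exact (measureReal_eq_measureReal_iff).1 heq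

/-- Each of the `N - 1` bonds has a clock of rate `Λ`, so the number of jumps up to time `t` has
mean `Λ (N - 1) t`. -/
theorem isTransitionSemigroup_poissonizedKernel (hN : 2 ≤ N) (hΛ : 0 ≤ Λ) :
    IsTransitionSemigroup Λ P fun t =>
      poissonizedKernel (jumpKernel ε N P) (Λ.toNNReal * (N - 1 : ℕ) * t) where
  markov _ := inferInstance
  zero := by rw [mul_zero]; exact poissonizedKernel_zero _
  add s t := by rw [mul_add]; exact poissonizedKernel_add _ _ _
  hasGenerator A hA := by
    rintro ⟨C, hC⟩
    have := tendstoUniformly_poissonizedKernel (jumpKernel ε N P) (Λ.toNNReal * (N - 1 : ℕ)) hA hC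
    rw [funext (generator_eq P hN Λ hA hC)]
    simpa only [NNReal.coe_mul, NNReal.coe_natCast, Real.coe_toNNReal _ hΛ] using this

end Semigroup

/-! ### Vaserstein distance -/

section Vaserstein

variable {ε : ℝ} {N : ℕ}

theorem vaserstein2_le {μ ν : Measure (simplex ε N)} {Γ : Measure (simplex ε N × simplex ε N)}
    (hΓ : Γ ∈ Coupling μ ν) : vaserstein2 μ ν ≤ √(∫ z, cost z ∂Γ) :=
  ciInf_le (f := fun Γ : Coupling μ ν => √(∫ z, adaptedDist z.1 z.2 ^ 2 ∂Γ.1))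
    ⟨0, by rintro _ ⟨Γ, rfl⟩; exact Real.sqrt_nonneg _⟩ ⟨Γ, hΓ⟩

theorem vaserstein2_le_diam (hN : 0 < N) (hε : 0 ≤ ε) (μ ν : Measure (simplex ε N))
    [IsProbabilityMeasure μ] [IsProbabilityMeasure ν] :
    vaserstein2 μ ν ≤ ε * N * √((N : ℝ) - 1) := by
  refine (vaserstein2_le (prod_mem_coupling μ ν)).trans ?_
  have h : ∫ z, cost z ∂(μ.prod ν) ≤ (ε * N) ^ 2 * (N - 1) :=
    (le_abs_self _).trans (abs_integral_le_of_abs_le (abs_cost_le hN))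
  refine (Real.sqrt_le_sqrt h).trans (le_of_eq ?_)
  rw [Real.sqrt_mul (sq_nonneg _), Real.sqrt_sq (by positivity)]

/-- A kernel that contracts the squared distance along a coupling contracts the Vaserstein
distance. -/
theorem vaserstein2_bind_le (hN : 0 < N) {K : Kernel (simplex ε N) (simplex ε N)}
    {K' : Kernel (simplex ε N × simplex ε N) (simplex ε N × simplex ε N)} [IsMarkovKernel K']
    (h1 : ∀ z, (K' z).map Prod.fst = K z.1) (h2 : ∀ z, (K' z).map Prod.snd = K z.2)
    {a : ℝ} (h : ∀ z, ∫ w, cost w ∂(K' z) ≤ Real.exp (-(2 * a)) * cost z)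
    (μ ν : Measure (simplex ε N)) [IsProbabilityMeasure μ] [IsProbabilityMeasure ν] :
    vaserstein2 (μ.bind K) (ν.bind K) ≤ vaserstein2 μ ν * Real.exp (-a) := by
  have : Nonempty (Coupling μ ν) := ⟨⟨_, prod_mem_coupling μ ν⟩⟩
  -- The claim becomes a lower bound for an infimum and is checked coupling by coupling, so no
  -- optimal coupling is needed.
  rw [← div_le_iff₀ (Real.exp_pos _)]
  refine le_ciInf fun ⟨Γ, hΓ⟩ => ?_
  rw [div_le_iff₀ (Real.exp_pos _)]
  have := isProbabilityMeasure_of_mem_coupling hΓ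
  refine (vaserstein2_le (bind_mem_coupling h1 h2 hΓ)).trans ?_
  refine (Real.sqrt_le_sqrt
    (integral_bind_le_of_contraction measurable_cost (abs_cost_le hN) h Γ)).trans (le_of_eq ?_)
  have e : Real.exp (-(2 * a)) = Real.exp (-a) ^ 2 := by
    rw [← Real.exp_nat_mul]; ring_nf
  rw [e, Real.sqrt_mul (sq_nonneg _), Real.sqrt_sq (Real.exp_pos _).le, mul_comm]
  rfl

end Vaserstein

end EnergyExchange

end

/-! ### The main theorem -/

open EnergyExchange in
theorem mainTheorem3 (N : ℕ) (hN : 2 ≤ N) (ε : ℝ) (hε : 0 < ε) (Λ : ℝ) (hΛ : 0 < Λ)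
    (P : Measure unitInterval) [IsProbabilityMeasure P]
    (hmean : ∫ α, (α : ℝ) ∂P = 1 / 2)
    (hvar : variance (fun α : unitInterval => (α : ℝ)) P < 1 / 4) :
    -- the Markov process with the given generator exists and its transition semigroup is unique
    (∃! κ : ℝ≥0 → Kernel (simplex ε N) (simplex ε N), IsTransitionSemigroup Λ P κ) ∧
    ∀ κ : ℝ≥0 → Kernel (simplex ε N) (simplex ε N), IsTransitionSemigroup Λ P κ →
      ∃ π : Measure (simplex ε N),
        (IsProbabilityMeasure π ∧ IsStationary κ π) ∧
        (∀ π' : Measure (simplex ε N), IsProbabilityMeasure π' → IsStationary κ π' → π' = π) ∧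
        -- `μ.bind (κ t)` is the law at time `t` of the process with initial law `μ`
        ∀ μ : Measure (simplex ε N), IsProbabilityMeasure μ → ∀ t : ℝ≥0,
          vaserstein2 (μ.bind (κ t)) π ≤
            vaserstein2 μ π *
              Real.exp (-(1 / 2 * Λ * (1 - 4 * variance (fun α : unitInterval => (α : ℝ)) P) *
                Real.sin (Real.pi / (N + 2)) ^ 2 * t)) ∧
          vaserstein2 μ π *
              Real.exp (-(1 / 2 * Λ * (1 - 4 * variance (fun α : unitInterval => (α : ℝ)) P) *
                Real.sin (Real.pi / (N + 2)) ^ 2 * t)) ≤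
            ε * N * √((N : ℝ) - 1) *
              Real.exp (-(1 / 2 * Λ * (1 - 4 * variance (fun α : unitInterval => (α : ℝ)) P) *
                Real.sin (Real.pi / (N + 2)) ^ 2 * t)) := by
  have hN0 : 0 < N := by omega
  have := isProbabilityMeasure_bondLaw hN P
  have := nonempty_simplex hN0 hε.le
  set v := variance (fun α : unitInterval => (α : ℝ)) P
  set s := Real.sin (Real.pi / (N + 2)) ^ 2 with hs
  have hM : (1 : ℝ) ≤ (N - 1 : ℕ) := by
    have : 1 ≤ N - 1 := by omega
    exact_mod_cast this
  have hv0 : 0 ≤ v := variance_nonneg _ _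
  have hs0 : 0 < s := by
    refine pow_pos (Real.sin_pos_of_pos_of_lt_pi (by positivity) ?_) 2
    rw [div_lt_iff₀ (by positivity)]
    nlinarith [Real.pi_pos, (Nat.cast_nonneg N : (0 : ℝ) ≤ N)]
  have hs1 : s ≤ 1 := Real.sin_sq_le_one _
  have hg0 : 0 < (1 - 4 * v) * s := mul_pos (by linarith) hs0
  have hg1 : (1 - 4 * v) * s ≤ 1 := by nlinarith
  set ρ : ℝ := 1 - (1 - 4 * v) * s / (N - 1 : ℕ) with hρdef
  have hρ0 : 0 ≤ ρ := by
    have : (1 - 4 * v) * s / (N - 1 : ℕ) ≤ 1 := (div_le_one (by linarith)).2 (by linarith)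
    linarith
  have hρ1 : ρ < 1 := by
    have : 0 < (1 - 4 * v) * s / (N - 1 : ℕ) := by positivity
    linarith
  have hstep : ∀ z, ∫ w, cost w ∂(pairJumpKernel ε N P z) ≤ ρ * cost z :=
    integral_cost_pairJumpKernel_le P hN hmean hvar
  have hsg := isTransitionSemigroup_poissonizedKernel (ε := ε) (P := P) hN hΛ.le
  refine ⟨⟨_, hsg, fun κ hκ => hκ.unique hsg hN hΛ.le⟩, fun κ hκ => ?_⟩
  -- By uniqueness any semigroup with this generator is the Poissonized jump chain.
  obtain rfl := hκ.unique hsg hN hΛ.le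
  -- The `N - 1` in the jump rate cancels the one in `1 - ρ`, leaving twice the asserted rate, as
  -- suits the squared distance.
  have hrate : ∀ t : ℝ≥0, (1 - ρ) * ((Λ.toNNReal * (N - 1 : ℕ) * t : ℝ≥0) : ℝ) =
      2 * (1 / 2 * Λ * (1 - 4 * v) * s * t) := by
    intro t
    rw [NNReal.coe_mul, NNReal.coe_mul, NNReal.coe_natCast, Real.coe_toNNReal _ hΛ.le, hρdef]
    field_simp
    ring
  have hcontr : ∀ (t : ℝ≥0) z, ∫ w, cost w ∂(poissonizedKernel (pairJumpKernel ε N P)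
      (Λ.toNNReal * (N - 1 : ℕ) * t) z) ≤
        Real.exp (-(2 * (1 / 2 * Λ * (1 - 4 * v) * s * t))) * cost z := by
    intro t z
    rw [← hrate]
    exact integral_poissonizedKernel_le_of_contraction measurable_cost (abs_cost_le hN0) hρ0 hρ1.le
      hstep _ z
  have hfst := fun t : ℝ≥0 => poissonizedKernel_map_of_intertwined measurable_fst
    (pairJumpKernel_map_fst (ε := ε) (N := N) P) (Λ.toNNReal * (N - 1 : ℕ) * t)
  have hsnd := fun t : ℝ≥0 => poissonizedKernel_map_of_intertwined measurable_snd
    (pairJumpKernel_map_snd (ε := ε) (N := N) P) (Λ.toNNReal * (N - 1 : ℕ) * t)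
  obtain ⟨π, hπ, hinv⟩ := exists_invariant_of_contraction continuous_cost measurable_cost
    cost_nonneg (eq_of_cost_eq_zero hN0) (abs_cost_le hN0)
    (fun A hA => continuous_integral_jumpKernel P hA) (pairJumpKernel_map_fst (ε := ε) (N := N) P)
    (pairJumpKernel_map_snd P) hρ0 hρ1 hstep
  have hstat : ∀ t : ℝ≥0, (poissonizedKernel (jumpKernel ε N P)
      (Λ.toNNReal * (N - 1 : ℕ) * t)).Invariant π := fun t => invariant_poissonizedKernel hinv _
  refine ⟨π, ⟨hπ, hstat⟩, fun π' hπ' hstat' => ?_, fun μ hμ t => ⟨?_, ?_⟩⟩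
  · refine eq_of_forall_exists_coupling_le continuous_cost measurable_cost cost_nonneg
      (eq_of_cost_eq_zero hN0) (abs_cost_le hN0) fun η hη => ?_
    -- Stationarity keeps both marginals fixed while the coupled process drives the cost of the
    -- product coupling to zero; integer times suffice.
    have hexp : Tendsto (fun n : ℕ => Real.exp (-(2 * (1 / 2 * Λ * (1 - 4 * v) * s *
        ((n : ℝ≥0) : ℝ)))) * ∫ z, cost z ∂(π'.prod π)) atTop (𝓝 (0 * ∫ z, cost z ∂(π'.prod π))) := by
      refine Tendsto.mul_const _ (Real.tendsto_exp_neg_atTop_nhds_zero.comp ?_)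
      refine Tendsto.const_mul_atTop two_pos (Tendsto.const_mul_atTop ?_ ?_)
      · rw [mul_assoc]; positivity
      · simpa using tendsto_natCast_atTop_atTop
    rw [zero_mul] at hexp
    obtain ⟨n, hn⟩ := (hexp.eventually (eventually_le_nhds hη)).exists
    have hΓ := bind_mem_coupling (hfst n) (hsnd n) (prod_mem_coupling π' π)
    rw [(hstat n).def, (hstat' n).def] at hΓ
    exact ⟨_, hΓ, (integral_bind_le_of_contraction measurable_cost (abs_cost_le hN0)
      (hcontr n) _).trans hn⟩
  · have h := vaserstein2_bind_le hN0 (hfst t) (hsnd t) (hcontr t) μ π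
    rwa [(hstat t).def] at h
  · exact mul_le_mul_of_nonneg_right (vaserstein2_le_diam hN0 hε.le μ π) (Real.exp_pos _).le
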